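/- **Theorem 3.1.** For $t\ge 0$ let $P(t,u)=e^{t\sqrt{1-u^2}}\big/\int_{-1}^1 e^{t\sqrt{1-v^2}}\,dv$ for $|u|\le 1$ and $P(t,u)=0$ for $|u|>1$, and for $N\ge1$ let $$p^{(N)}(t,u)=\int \delta\Big(u-\frac1N\sum_{i=1}^N u_i\Big)\prod_{i=1}^N P\big(\tfrac tN,u_i\big)\,du_i = N\int_{\mathbb R^{N-1}} \prod_{i=1}^{N-1}P\big(\tfrac tN,u_i\big)\; P\big(\tfrac tN,\,Nu-u_1-\dots-u_{N-1}\big)\,du_1\cdots du_{N-1}.$$ Fix $t\ge 0$. Suppose that there are functions $A_N(u)\in\mathbb R$ and $f(\tau,u)\in[-\infty,\infty)$ ($\tau\ge0$, $u\in[-1,1]$) such that, for every $u\in[-1,1]$, $A_N(u)/A_{N-1}(u)\to1$ as $N\to\infty$, the map $\tau\mapsto f(\tau,u)$ is continuous from the right at $\tau=0$, and, with $\tau=t/N$, $$p^{(N)}(N\tau,u)=A_N(u)\,e^{Nf(\tau,u)}\,\big(1+O(1/N)\big)\qquad(N\to\infty,\ e^{-\infty}=0).$$ Put $f_1(u)=f(0,u)$,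 $u(y)=\frac1y-\coth y$ for $y\ne0$, $u(0)=0$, and $\varphi(y)=\ln\frac{\sinh y}{y}$ for $y\neq 0$, $\varphi(0)=0$. Then: 1. $y\mapsto u(y)$ is a continuous, strictly decreasing bijection of $\mathbb R$ onto $(-1,1)$, with $u(y)\to1$ as $y\to-\infty$ and $u(y)\to-1$ as $y\to+\infty$. 2. $f_1(u(y))=u(y)\,y+\varphi(y)$ for all $y\in\mathbb R$. 3. $f_1(0)=0$, $f_1(1)=f_1(-1)=-\infty$, and $f_1(u)\to-\infty$ as $u\to\pm1$ within $(-1,1)$. 4. $f_1$ is differentiable on $(-1,1)$ with $f_1'(u(y))=y$, and it is the unique singular solution on $(-1,1)$ of the Clairaut equation $$g(u)=u\,g'(u)+\varphi(g'(u)),$$ where a singular solution is a differentiable solution that coincides on no nonempty open subinterval with a member $Cu+\varphi(C)$ of the general solution. 5. (Agreement with the asymptotics of the cube slab volumes, Theorem 2.3.) Let $V_{N-1}(\beta)$ be the volume of $\{y\in[0,1]^{N-1}:\beta N-1\le\sum_j y_j\le\beta N\}$. Then $p^{(N)}(0,u)=\frac N2V_{N-1}\big(\frac{1-u}2\big)$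 for $N\ge1$ and $u\in[-1,1]$. Let $F:[0,1]\to\mathbb R$ be the function given parametrically by $$F=\frac{z^{z/(1-z)}(z-1)e}{\ln z},\quad \beta=\frac1{1-z}+\frac1{\ln z}\quad(z>0,\ z\ne1),\qquad F(0)=F(1)=0,\quad F(\tfrac12)=1.$$ Then this $F$ is well defined and $F\big(\frac{1-u}2\big)=e^{f_1(u)}$ for all $u\in[-1,1]$; the two parametrizations correspond under $z=e^{-2y}$, that is, for $y\ne0$ this $z$ gives $\beta=\frac{1-u(y)}2$ and $F=e^{f_1(u(y))}$. -/

import Mathlib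

open Set Filter Topology MeasureTheory Asymptotics

namespace RelBrownian

/-- The one-step probability density `P(t, u)` on `[-1, 1]`, proportional to `exp (t √(1 - u²))`. -/
noncomputable def stepDensity (t u : ℝ) : ℝ :=
  (Icc (-1 : ℝ) 1).indicator (fun v => Real.exp (t * √(1 - v ^ 2))) u /
    ∫ v in (-1 : ℝ)..1, Real.exp (t * √(1 - v ^ 2))

/-- `p^(N)(t, u) = ∫ δ(u - (u₁ + ⋯ + u_N) / N) ∏ P(t / N, uᵢ) duᵢ`, the density at `u` of the mean of
`N` independent steps. The delta function is integrated out in the last variable: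
`δ(u - S / N) = N δ(N u - S)`, so `u_N = N u - (u₁ + ⋯ + u_{N-1})` and a factor `N` appears. -/
noncomputable def meanDensity (N : ℕ) (t u : ℝ) : ℝ :=
  N * ∫ v : Fin (N - 1) → ℝ,
    (∏ i, stepDensity (t / N) (v i)) * stepDensity (t / N) (N * u - ∑ i, v i)

/-- The asymptotic form `p^(N)(Nτ, u) = A_N(u) exp (N f(τ, u)) (1 + O(1/N))` as `N → ∞`, where
`Nτ = t` is fixed, for every `u` in `[-1, 1]`. The exponent takes values in `[-∞, ∞)`,
with `exp (-∞) = 0`. -/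
structure HasAsymptoticForm (t : ℝ) (A : ℕ → ℝ → ℝ) (f : ℝ → ℝ → EReal) : Prop where
  lt_top : ∀ τ, 0 ≤ τ → ∀ u ∈ Icc (-1 : ℝ) 1, f τ u < ⊤
  continuous_zero : ∀ u ∈ Icc (-1 : ℝ) 1, ContinuousWithinAt (fun τ => f τ u) (Ici 0) 0
  ratio : ∀ u ∈ Icc (-1 : ℝ) 1, Tendsto (fun N => A (N + 1) u / A N u) atTop (𝓝 1)
  asymptotic : ∀ u ∈ Icc (-1 : ℝ) 1, ∃ r : ℕ → ℝ,
    r =O[atTop] (fun N : ℕ => 1 / (N : ℝ)) ∧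
    ∀ᶠ N : ℕ in atTop, meanDensity N t u =
      A N u * (EReal.exp ((N : EReal) * f (t / N) u)).toReal * (1 + r N)

/-- `ln (sinh y / y)`, with its limit value `0` at `y = 0`. -/
noncomputable def logSinhc (y : ℝ) : ℝ := if y = 0 then 0 else Real.log (Real.sinh y / y)

/-- `1 / y - coth y`, with its limit value `0` at `y = 0`. -/
noncomputable def uParam (y : ℝ) : ℝ := if y = 0 then 0 else 1 / y - Real.cosh y / Real.sinh y

/-- `g` solves the Clairaut equation `g = u g' + φ(g')` on the open set `s`. -/
def IsClairautSolution (φ g : ℝ → ℝ) (s : Set ℝ) : Prop :=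
  ∀ u ∈ s, DifferentiableAt ℝ g u ∧ g u = u * deriv g u + φ (deriv g u)

/-- A singular solution on the open set `s`: a solution that near no point of `s` coincides with a
member `C u + φ(C)` of the general solution. -/
def IsSingularClairautSolution (φ g : ℝ → ℝ) (s : Set ℝ) : Prop :=
  IsClairautSolution φ g s ∧ ∀ u ∈ s, ∀ C : ℝ, ¬ (g =ᶠ[𝓝 u] fun v => C * v + φ C)

/-- The part of the `(N-1)`-dimensional unit cube where `β N - 1 ≤ y₁ + ⋯ + y_{N-1} ≤ β N`. -/
def cubeSlab (N : ℕ) (β : ℝ) : Set (Fin (N - 1) → ℝ) :=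
  {y | (∀ i, 0 ≤ y i ∧ y i ≤ 1) ∧ β * N - 1 ≤ ∑ i, y i ∧ ∑ i, y i ≤ β * N}

/-- `β(z) = 1 / (1 - z) + 1 / ln z`, for `z > 0`, `z ≠ 1`. -/
noncomputable def polyBeta (z : ℝ) : ℝ := 1 / (1 - z) + 1 / Real.log z

/-- `z ^ (z / (1 - z)) (z - 1) e / ln z`, for `z > 0`, `z ≠ 1`. -/
noncomputable def polyRate (z : ℝ) : ℝ :=
  z ^ (z / (1 - z)) * (z - 1) * Real.exp 1 / Real.log z

/-- The exponential rate of the slab volumes as a function of `β`, given parametrically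
by `z`: `PolyGraph β w` says that its value at `β` is `w`. The parameters
`z = ∞`, `z = 0` and `z = 1` stand for `β = 0`, `β = 1` and `β = 1 / 2`. -/
inductive PolyGraph : ℝ → ℝ → Prop
  | zero : PolyGraph 0 0
  | one : PolyGraph 1 0
  | half : PolyGraph (1 / 2) 1
  | param (z : ℝ) (hz : 0 < z) (hz1 : z ≠ 1) : PolyGraph (polyBeta z) (polyRate z)

end RelBrownian

open RelBrownian

/-! At time step `t / N` each of the `N` factors differs from the uniform density on `[-1, 1]` by a
factor between `exp (-t / N)` and `exp (t / N)`, so their product differs from the case `t = 0` by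
at most `exp (±t)`, uniformly in `N`. The exponential rate is therefore that of a sum of uniform
variables, and Cramér's theorem gives it as the Legendre transform of the cumulant function
`logSinhc`: the infimum over `q` of `u * q + logSinhc q`, attained where `uParam q = u`.

The upper bound is Chernoff's (`boxConv_le`). The lower bound avoids the central limit theorem: the
law with density proportional to `exp (-(y * x))` has mean `uParam y`, and convolution with the
centred tilted law preserves a wide tent function up to a factor close to `1` (`tent_le_integral`,
`exists_le_boxConv`). Together they give `tendsto_log_meanDensity_div`. The prefactor `A N u` is
subexponential by Cesàro averaging, so taking logarithms in the asymptotic form and using right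
continuity at `0` identifies `f 0` (`HasAsymptoticForm.eq_coe`). At `u = ±1` the density vanishes
for `N ≥ 2`, which forces the value `⊥`.

The rest is convex duality. The tangent line inequality `logSinhc_sub_le` gives the derivative of
the transform, its limits at the end points and the Clairaut equation. Uniqueness holds because a
solution that differs from the transform has its derivative strictly on one side of the singular
value nearby, which forces that derivative to be constant. -/

namespace RelBrownian

/-! ### Convolutions of the uniform law -/

/-- The `n`-fold convolution of the indicator of `[-1, 1]` with itself (unnormalized). -/
noncomputable def boxConv : ℕ → ℝ → ℝ
  | 0, s => (Icc (-1 : ℝ) 1).indicator (fun _ => 1) s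
  | n + 1, s => ∫ x in (-1 : ℝ)..1, boxConv n (s - x)

lemma boxConv_zero (s : ℝ) : boxConv 0 s = (Icc (-1 : ℝ) 1).indicator (fun _ => 1) s := rfl

lemma boxConv_succ (n : ℕ) (s : ℝ) :
    boxConv (n + 1) s = ∫ x in (-1 : ℝ)..1, boxConv n (s - x) := rfl

lemma boxConv_succ' (n : ℕ) (s : ℝ) :
    boxConv (n + 1) s = ∫ x in (s - 1)..(s + 1), boxConv n x := by
  rw [boxConv_succ, intervalIntegral.integral_comp_sub_left, sub_neg_eq_add]

lemma boxConv_intervalIntegrable (n : ℕ) :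
    ∀ a b : ℝ, IntervalIntegrable (boxConv n) volume a b := by
  induction n with
  | zero =>
    intro a b
    have h : Integrable ((Icc (-1 : ℝ) 1).indicator (fun _ => (1 : ℝ))) volume :=
      (integrable_indicator_iff measurableSet_Icc).2 (integrableOn_const (by simp))
    exact h.intervalIntegrable
  | succ n ih =>
    intro a b
    have hc := intervalIntegral.continuous_primitive ih 0
    have : boxConv (n + 1) = fun s => (∫ x in (0 : ℝ)..(s + 1), boxConv n x) -
        ∫ x in (0 : ℝ)..(s - 1), boxConv n x := by
      funext s
      rw [boxConv_succ', intervalIntegral.integral_interval_sub_left (ih _ _) (ih _ _)]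
    rw [this]
    exact ((hc.comp (continuous_id.add continuous_const)).sub
      (hc.comp (continuous_id.sub continuous_const))).intervalIntegrable _ _

lemma boxConv_comp_sub_intervalIntegrable (n : ℕ) (s a b : ℝ) :
    IntervalIntegrable (fun x => boxConv n (s - x)) volume a b := by
  simpa using (boxConv_intervalIntegrable n (s - a) (s - b)).comp_sub_left s

lemma boxConv_nonneg (n : ℕ) : ∀ s, 0 ≤ boxConv n s := by
  induction n with
  | zero => intro s; exact indicator_nonneg (fun _ _ => zero_le_one) s
  | succ n ih =>
    intro s
    exact intervalIntegral.integral_nonneg (by norm_num) fun x _ => ih _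

/-! ### Exponential tilting: upper and lower bounds for the convolutions -/

lemma integral_exp_neg_mul_box (y : ℝ) :
    ∫ x in (-1 : ℝ)..1, Real.exp (-(y * x)) = 2 * Real.exp (logSinhc y) := by
  unfold logSinhc
  split_ifs with h
  · simp [h]; norm_num
  · have hpos : 0 < Real.sinh y / y := by
      rcases lt_or_gt_of_ne h with h' | h'
      · exact div_pos_of_neg_of_neg (Real.sinh_neg_iff.2 h') h'
      · exact div_pos (Real.sinh_pos_iff.2 h') h'
    rw [Real.exp_log hpos]
    have hd : ∀ x ∈ uIcc (-1 : ℝ) 1,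
        HasDerivAt (fun x => -(Real.exp (-(y * x)) / y)) (Real.exp (-(y * x))) x := by
      intro x _
      have hx : HasDerivAt (fun x => -(y * x)) (-(y * 1)) x := ((hasDerivAt_id x).const_mul y).neg
      refine (hx.exp.div_const y).neg.congr_deriv ?_
      field_simp
    rw [intervalIntegral.integral_eq_sub_of_hasDerivAt hd
      (by apply Continuous.intervalIntegrable; fun_prop), Real.sinh_eq]
    simp only [mul_one, mul_neg, neg_neg]
    field_simp
    ring

/-- This is where the parametrization comes from: `uParam y` is the mean of the tilted law. -/
lemma integral_mul_exp_neg_mul_box (y : ℝ) :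
    ∫ x in (-1 : ℝ)..1, x * Real.exp (-(y * x)) = uParam y * (2 * Real.exp (logSinhc y)) := by
  by_cases h : y = 0
  · simp [h, uParam]
  have hs : Real.sinh y ≠ 0 := by simpa [Real.sinh_eq_zero] using h
  have hpos : 0 < Real.sinh y / y := by
    rcases lt_or_gt_of_ne h with h' | h'
    · exact div_pos_of_neg_of_neg (Real.sinh_neg_iff.2 h') h'
    · exact div_pos (Real.sinh_pos_iff.2 h') h'
  have hd : ∀ x ∈ uIcc (-1 : ℝ) 1,
      HasDerivAt (fun x => -((x / y + 1 / y ^ 2) * Real.exp (-(y * x))))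
        (x * Real.exp (-(y * x))) x := by
    intro x _
    have hx : HasDerivAt (fun x => -(y * x)) (-(y * 1)) x := ((hasDerivAt_id x).const_mul y).neg
    have hx' : HasDerivAt (fun x => x / y + 1 / y ^ 2) (1 / y) x :=
      ((hasDerivAt_id x).div_const y).add_const _
    refine (hx'.mul hx.exp).neg.congr_deriv ?_
    field_simp
    ring
  rw [intervalIntegral.integral_eq_sub_of_hasDerivAt hd
    (by apply Continuous.intervalIntegrable; fun_prop)]
  simp only [logSinhc, uParam, if_neg h]
  rw [Real.exp_log hpos]
  simp only [mul_one, mul_neg, neg_neg]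
  have : (1 / y - Real.cosh y / Real.sinh y) * (2 * (Real.sinh y / y)) =
      2 * Real.sinh y / y ^ 2 - 2 * Real.cosh y / y := by field_simp
  rw [this, Real.sinh_eq, Real.cosh_eq]
  field_simp
  ring

/-- Chernoff's bound: an exponential `exp (y * s)` is an eigenfunction of convolution with the box,
and `exp |y|` makes it dominate the indicator at the start. -/
lemma boxConv_le (y : ℝ) (n : ℕ) : ∀ s,
    boxConv n s ≤ Real.exp |y| * Real.exp (y * s) * (2 * Real.exp (logSinhc y)) ^ n := by
  induction n with
  | zero =>
    intro s
    rw [boxConv_zero, pow_zero, mul_one, ← Real.exp_add]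
    by_cases hs : s ∈ Icc (-1 : ℝ) 1
    · rw [indicator_of_mem hs]
      apply Real.one_le_exp
      have h1 : |y * s| ≤ |y| := by
        rw [abs_mul]; exact mul_le_of_le_one_right (abs_nonneg _) (abs_le.2 hs)
      linarith [neg_abs_le (y * s)]
    · rw [indicator_of_notMem hs]; positivity
  | succ n ih =>
    intro s
    rw [boxConv_succ]
    calc ∫ x in (-1 : ℝ)..1, boxConv n (s - x)
        ≤ ∫ x in (-1 : ℝ)..1, Real.exp |y| * Real.exp (y * s) *
            (2 * Real.exp (logSinhc y)) ^ n * Real.exp (-(y * x)) := by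
          apply intervalIntegral.integral_mono_on (by norm_num)
            (boxConv_comp_sub_intervalIntegrable _ _ _ _)
            (by apply Continuous.intervalIntegrable; fun_prop)
          intro x _
          refine (ih (s - x)).trans_eq ?_
          rw [mul_sub, sub_eq_add_neg, Real.exp_add]; ring
      _ = _ := by
          rw [intervalIntegral.integral_const_mul, integral_exp_neg_mul_box]; ring

/-- A crude bound that only has to seed the tent argument. The window `[s - 1, s + 1]` contains a
subinterval of length `1 - θ` on which the previous bound applies, at the end nearer to the origin.
-/
lemma pow_le_boxConv {θ : ℝ} (hθ : 0 ≤ θ) (hθ1 : θ < 1) (n : ℕ) :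
    ∀ s, |s| ≤ 1 + n * θ → (1 - θ) ^ n ≤ boxConv n s := by
  induction n with
  | zero =>
    intro s hs
    rw [boxConv_zero, indicator_of_mem (by simpa [abs_le] using hs)]; simp
  | succ n ih =>
    intro s hs
    rw [boxConv_succ']
    push_cast at hs
    have hn : 0 ≤ n * θ := by positivity
    rw [abs_le] at hs
    have key : ∀ a b : ℝ, s - 1 ≤ a → b ≤ s + 1 → -(1 + n * θ) ≤ a → b ≤ 1 + n * θ →
        b = a + (1 - θ) → (1 - θ) ^ (n + 1) ≤ ∫ x in (s - 1)..(s + 1), boxConv n x := by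
      intro a b ha hb ha' hb' hab
      have hle : a ≤ b := by linarith
      calc (1 - θ) ^ (n + 1) = ∫ x in a..b, (1 - θ) ^ n := by
            rw [intervalIntegral.integral_const, hab, smul_eq_mul]; ring
        _ ≤ ∫ x in a..b, boxConv n x := by
            apply intervalIntegral.integral_mono_on hle (by simp)
              (boxConv_intervalIntegrable _ _ _)
            intro x hx
            exact ih x (abs_le.2 ⟨by linarith [hx.1], by linarith [hx.2]⟩)
        _ ≤ _ := intervalIntegral.integral_mono_interval ha hle hb
            (Eventually.of_forall fun x => boxConv_nonneg n x)
            (boxConv_intervalIntegrable _ _ _)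
    rcases le_total 0 s with h0 | h0
    · exact key (s - 1) (s - θ) le_rfl (by linarith) (by linarith) (by linarith) (by ring)
    · exact key (s + θ) (s + 1) (by linarith) le_rfl (by linarith) (by linarith) (by ring)

/-- The tent `max 0 (R - |z|)` is almost preserved by averaging against a centred law on an interval
of length two. -/
lemma tent_le_integral {R y : ℝ} (hR : 2 < R) (hu : |uParam y| ≤ 1) (z : ℝ) :
    (1 - 2 / (R - 2)) * (2 * Real.exp (logSinhc y)) * max 0 (R - |z|) ≤
      ∫ x in (-1 : ℝ)..1, Real.exp (-(y * x)) * max 0 (R - |z - (x - uParam y)|) := by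
  set u := uParam y with hu_def
  set M := 2 * Real.exp (logSinhc y) with hM
  have hM0 : 0 < M := by positivity
  have hR2 : 0 < R - 2 := by linarith
  have hδ : 0 < 2 / (R - 2) := by positivity
  have hint : IntervalIntegrable (fun x => Real.exp (-(y * x)) * max 0 (R - |z - (x - u)|))
      volume (-1) 1 := by
    apply Continuous.intervalIntegrable; fun_prop
  have hu' := abs_le.1 hu
  -- Away from the apex the tent is the positive part of an affine function of slope `±1` on the
  -- whole range of the average. Jensen's inequality then gives no loss, since the law is centred.
  have lin : ∀ σ : ℝ, (∀ x ∈ Icc (-1 : ℝ) 1, R - |z| + σ * (x - u) ≤ R - |z - (x - u)|) →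
      (1 - 2 / (R - 2)) * M * max 0 (R - |z|) ≤
      ∫ x in (-1 : ℝ)..1, Real.exp (-(y * x)) * max 0 (R - |z - (x - u)|) := by
    intro σ hσ
    rcases le_total (R - |z|) 0 with h | h
    · rw [max_eq_left h, mul_zero]
      exact intervalIntegral.integral_nonneg (by norm_num) fun x _ => by positivity
    · rw [max_eq_right h]
      calc (1 - 2 / (R - 2)) * M * (R - |z|) ≤ M * (R - |z|) := by
            have : 0 ≤ 2 / (R - 2) * (M * (R - |z|)) := by positivity
            linarith
        _ = ∫ x in (-1 : ℝ)..1, ((R - |z| - σ * u) * Real.exp (-(y * x)) +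
              σ * (x * Real.exp (-(y * x)))) := by
            rw [intervalIntegral.integral_add (by apply Continuous.intervalIntegrable; fun_prop)
              (by apply Continuous.intervalIntegrable; fun_prop),
              intervalIntegral.integral_const_mul, intervalIntegral.integral_const_mul,
              integral_exp_neg_mul_box, integral_mul_exp_neg_mul_box]
            ring
        _ ≤ _ := by
            apply intervalIntegral.integral_mono_on (by norm_num)
              (by apply Continuous.intervalIntegrable; fun_prop) hint
            intro x hx
            have h1 := (hσ x hx).trans (le_max_right 0 _)
            have := mul_le_mul_of_nonneg_left h1 (Real.exp_pos (-(y * x))).le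
            linarith
  -- A displacement `x - u` is at most `2` in size. So for `|z| > 2` the sign of the argument is
  -- kept, and for `|z| ≤ 2` the height drops by at most `2` from at least `R - 2`.
  rcases le_or_gt |z| 2 with hz | hz
  · have h0 : 0 ≤ R - |z| := by linarith
    rw [max_eq_right h0, hM, ← integral_exp_neg_mul_box y, mul_comm (1 - 2 / (R - 2)), mul_assoc,
      ← intervalIntegral.integral_mul_const]
    apply intervalIntegral.integral_mono_on (by norm_num)
      (by apply Continuous.intervalIntegrable; fun_prop) hint
    intro x hx
    apply mul_le_mul_of_nonneg_left _ (Real.exp_pos _).le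
    refine le_trans ?_ (le_max_right _ _)
    have h1 : |x - u| ≤ 2 := abs_le.2 ⟨by linarith [hx.1], by linarith [hx.2]⟩
    have h2 : |z - (x - u)| ≤ |z| + |x - u| := abs_sub _ _
    have h3 : 2 ≤ 2 / (R - 2) * (R - |z|) := by
      rw [div_mul_eq_mul_div, le_div_iff₀ hR2]; linarith
    linarith
  · rcases lt_abs.1 hz with h | h
    · refine lin 1 fun x hx => ?_
      rw [abs_of_pos (by linarith : 0 < z), abs_of_nonneg (by linarith [hx.1, hx.2])]
      linarith
    · refine lin (-1) fun x hx => ?_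
      rw [abs_of_neg (by linarith : z < 0), abs_of_nonpos (by linarith [hx.1, hx.2])]
      linarith

/-- Each convolution moves the centre of the tent by the tilted mean and costs one factor `1 - 2 /
(R - 2)`; the weight `exp (y * s)` undoes the tilt. -/
lemma tent_le_boxConv {R y : ℝ} (hR : 4 ≤ R) (hu : |uParam y| ≤ 1) {c : ℝ} (hc : 0 ≤ c) {n₀ : ℕ}
    (h₀ : ∀ s, c * Real.exp (y * s) * max 0 (R - |s - n₀ * uParam y|) ≤ boxConv n₀ s) (n : ℕ) :
    ∀ s, c * ((1 - 2 / (R - 2)) * (2 * Real.exp (logSinhc y))) ^ n * Real.exp (y * s) *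
      max 0 (R - |s - (n₀ + n : ℕ) * uParam y|) ≤ boxConv (n₀ + n) s := by
  have hδ : 0 ≤ 1 - 2 / (R - 2) := by
    rw [sub_nonneg, div_le_one (by linarith)]; linarith
  induction n with
  | zero => intro s; simpa using h₀ s
  | succ n ih =>
    intro s
    rw [← add_assoc, boxConv_succ]
    set u := uParam y
    set L := (1 - 2 / (R - 2)) * (2 * Real.exp (logSinhc y)) with hL
    have hL0 : 0 ≤ L := by positivity
    have ht := tent_le_integral (by linarith : 2 < R) hu (s - (n₀ + n + 1 : ℕ) * u)
    rw [← hL] at ht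
    calc _ = c * L ^ n * Real.exp (y * s) *
          (L * max 0 (R - |s - (n₀ + n + 1 : ℕ) * u|)) := by ring
      _ ≤ c * L ^ n * Real.exp (y * s) * ∫ x in (-1 : ℝ)..1, Real.exp (-(y * x)) *
            max 0 (R - |s - (n₀ + n + 1 : ℕ) * u - (x - u)|) :=
          mul_le_mul_of_nonneg_left ht (by positivity)
      _ = ∫ x in (-1 : ℝ)..1, c * L ^ n * Real.exp (y * s) * (Real.exp (-(y * x)) *
            max 0 (R - |s - (n₀ + n + 1 : ℕ) * u - (x - u)|)) := by
          rw [intervalIntegral.integral_const_mul]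
      _ ≤ _ := by
          apply intervalIntegral.integral_mono_on (by norm_num)
            (by apply Continuous.intervalIntegrable; fun_prop)
            (boxConv_comp_sub_intervalIntegrable _ _ _ _)
          intro x _
          refine le_trans (le_of_eq ?_) (ih (s - x))
          have e1 : s - (n₀ + n + 1 : ℕ) * u - (x - u) = s - x - (n₀ + n : ℕ) * u := by
            push_cast; ring
          rw [e1, mul_sub, sub_eq_add_neg (y * s), Real.exp_add]
          ring

lemma exists_le_boxConv {y δ : ℝ} (hu : |uParam y| < 1) (hδ : 0 < δ) (hδ1 : δ ≤ 1) :
    ∃ c : ℝ, 0 < c ∧ ∃ n₀ : ℕ, ∀ n, n₀ ≤ n →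
      c * ((1 - δ) * (2 * Real.exp (logSinhc y))) ^ n * Real.exp (y * ((n + 1) * uParam y)) ≤
        boxConv n ((n + 1) * uParam y) := by
  set u := uParam y
  -- This width makes the loss per step exactly `δ`.
  set R := 2 + 2 / δ with hR
  have hδR : 2 / (R - 2) = δ := by rw [hR]; field_simp; ring
  have hR4 : 4 ≤ R := by
    have : 2 ≤ 2 / δ := by rw [le_div_iff₀ hδ]; linarith
    linarith
  obtain ⟨θ, huθ, hθ1⟩ := exists_between hu
  have hθ0 : 0 ≤ θ := (abs_nonneg _).trans huθ.le
  -- After `n₀` steps the region where `pow_le_boxConv` applies, growing at speed `θ > |u|`, covers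
  -- the whole tent centred at `n₀ * u`.
  obtain ⟨n₀, hn₀⟩ := exists_nat_ge (R / (θ - |u|))
  have hn₀' : R ≤ n₀ * (θ - |u|) := by rwa [div_le_iff₀ (by linarith)] at hn₀
  set c := (1 - θ) ^ n₀ / (R * Real.exp (|y| * (1 + n₀ * θ))) with hc
  have h1θ : 0 < 1 - θ := by linarith
  have hc0 : 0 < c := by positivity
  have h₀ : ∀ s, c * Real.exp (y * s) * max 0 (R - |s - n₀ * u|) ≤ boxConv n₀ s := by
    intro s
    rcases le_total (R - |s - n₀ * u|) 0 with h | h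
    · rw [max_eq_left h, mul_zero]; exact boxConv_nonneg _ _
    · rw [max_eq_right h]
      have hs : |s| ≤ 1 + n₀ * θ := by
        have h1 : |s| ≤ |s - n₀ * u| + |n₀ * u| := by
          simpa using abs_add_le (s - n₀ * u) (n₀ * u)
        rw [abs_mul, Nat.abs_cast] at h1
        linarith
      refine le_trans ?_ (pow_le_boxConv hθ0 hθ1 n₀ s hs)
      have h2 : Real.exp (y * s) ≤ Real.exp (|y| * (1 + n₀ * θ)) := by
        apply Real.exp_le_exp.2
        calc y * s ≤ |y * s| := le_abs_self _
          _ = |y| * |s| := abs_mul _ _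
          _ ≤ _ := by gcongr
      calc c * Real.exp (y * s) * (R - |s - n₀ * u|)
          ≤ c * Real.exp (|y| * (1 + n₀ * θ)) * R := by
            have : R - |s - n₀ * u| ≤ R := by linarith [abs_nonneg (s - n₀ * u)]
            gcongr
        _ = (1 - θ) ^ n₀ := by rw [hc]; field_simp
  -- Here `L` would be zero and could not be divided by; the claim is trivial for `n ≥ 1`.
  by_cases hδe : δ = 1
  · refine ⟨c, hc0, 1, fun n hn => ?_⟩
    rw [hδe, sub_self, zero_mul, zero_pow (by omega), mul_zero, zero_mul]
    exact boxConv_nonneg _ _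
  have hδ2 : 0 < 1 - δ := by
    have := lt_of_le_of_ne hδ1 hδe
    linarith
  set L := (1 - δ) * (2 * Real.exp (logSinhc y)) with hL
  have hL0 : 0 < L := by positivity
  refine ⟨c / L ^ n₀, by positivity, n₀, fun n hn => ?_⟩
  obtain ⟨k, rfl⟩ := Nat.exists_eq_add_of_le hn
  have := tent_le_boxConv hR4 hu.le hc0.le h₀ k ((↑(n₀ + k) + 1) * u)
  rw [hδR, ← hL] at this
  refine le_trans ?_ this
  -- `boxConv n` belongs to `n + 1` steps, so the evaluation point is one mean away from the centre
  -- of the tent, where the height is still at least `1`.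
  have e : ((↑(n₀ + k) + 1) * u - ↑(n₀ + k) * u) = u := by ring
  have h1 : (1 : ℝ) ≤ max 0 (R - |u|) := le_max_of_le_right (by linarith)
  rw [e]
  calc _ = c * L ^ k * Real.exp (y * ((↑(n₀ + k) + 1) * u)) * 1 := by
        rw [pow_add]; field_simp
    _ ≤ _ := by gcongr

/-! ### Comparison of the density at time `t` with time `0` -/

lemma stepDensity_zero (u : ℝ) :
    stepDensity 0 u = (Icc (-1 : ℝ) 1).indicator (fun _ => 1 / 2) u := by
  have : (∫ v in (-1 : ℝ)..1, Real.exp (0 * √(1 - v ^ 2))) = 2 := by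
    simp; norm_num
  rw [stepDensity, this]
  by_cases h : u ∈ Icc (-1 : ℝ) 1 <;> simp [h]

lemma exp_mul_sqrt_mem {t : ℝ} (ht : 0 ≤ t) (v : ℝ) :
    Real.exp (t * √(1 - v ^ 2)) ∈ Icc 1 (Real.exp t) := by
  refine ⟨Real.one_le_exp (by positivity), Real.exp_le_exp.2 ?_⟩
  refine mul_le_of_le_one_right ht ?_
  rw [Real.sqrt_le_left (by norm_num)]
  nlinarith [sq_nonneg v]

lemma integral_exp_mul_sqrt_mem {t : ℝ} (ht : 0 ≤ t) :
    (∫ v in (-1 : ℝ)..1, Real.exp (t * √(1 - v ^ 2))) ∈ Icc 2 (2 * Real.exp t) := by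
  have hi : IntervalIntegrable (fun v : ℝ => Real.exp (t * √(1 - v ^ 2))) volume (-1) 1 := by
    apply Continuous.intervalIntegrable; fun_prop
  constructor
  · have := intervalIntegral.integral_mono_on (by norm_num : (-1 : ℝ) ≤ 1)
      (by simp : IntervalIntegrable (fun _ : ℝ => (1 : ℝ)) volume (-1) 1) hi
      fun v _ => (exp_mul_sqrt_mem ht v).1
    refine le_trans (le_of_eq ?_) this
    simp; norm_num
  · have := intervalIntegral.integral_mono_on (by norm_num : (-1 : ℝ) ≤ 1) hi
      (by simp : IntervalIntegrable (fun _ : ℝ => Real.exp t) volume (-1) 1)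
      fun v _ => (exp_mul_sqrt_mem ht v).2
    refine this.trans (le_of_eq ?_)
    simp; norm_num

/-- The numerator lies in `[1, exp t]` and the normalization in `[2, 2 * exp t]`. -/
lemma stepDensity_le {t : ℝ} (ht : 0 ≤ t) (u : ℝ) :
    stepDensity t u ≤ Real.exp t * stepDensity 0 u := by
  have h1 := integral_exp_mul_sqrt_mem ht
  rw [stepDensity_zero, stepDensity]
  by_cases h : u ∈ Icc (-1 : ℝ) 1
  · have h2 := exp_mul_sqrt_mem ht u
    simp only [indicator_of_mem h]
    rw [mul_one_div]
    exact div_le_div₀ (Real.exp_pos t).le h2.2 two_pos h1.1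
  · simp [h]

lemma le_stepDensity {t : ℝ} (ht : 0 ≤ t) (u : ℝ) :
    Real.exp (-t) * stepDensity 0 u ≤ stepDensity t u := by
  have h1 := integral_exp_mul_sqrt_mem ht
  rw [stepDensity_zero, stepDensity]
  by_cases h : u ∈ Icc (-1 : ℝ) 1
  · have h2 := exp_mul_sqrt_mem ht u
    simp only [indicator_of_mem h]
    calc Real.exp (-t) * (1 / 2) = 1 / (2 * Real.exp t) := by
          rw [Real.exp_neg]; field_simp
      _ ≤ _ := div_le_div₀ (Real.exp_pos _).le h2.1 (by linarith [h1.1]) h1.2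
  · simp [h]

lemma stepDensity_nonneg {t : ℝ} (ht : 0 ≤ t) (u : ℝ) : 0 ≤ stepDensity t u := by
  refine le_trans ?_ (le_stepDensity ht u)
  rw [stepDensity_zero]
  exact mul_nonneg (Real.exp_pos _).le (indicator_nonneg (by norm_num) u)

@[fun_prop]
lemma measurable_stepDensity (t : ℝ) : Measurable (stepDensity t) := by
  unfold stepDensity
  exact (Measurable.indicator (by fun_prop) measurableSet_Icc).div_const _

lemma integrable_stepDensity_zero : Integrable (stepDensity 0) := by
  have : stepDensity 0 = (Icc (-1 : ℝ) 1).indicator (fun _ => 1 / 2) := funext stepDensity_zero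
  rw [this]
  exact (integrable_indicator_iff measurableSet_Icc).2 (integrableOn_const (by simp))

lemma integrable_stepDensity {t : ℝ} (ht : 0 ≤ t) : Integrable (stepDensity t) := by
  refine (integrable_stepDensity_zero.const_mul (Real.exp t)).mono'
    (measurable_stepDensity t).aestronglyMeasurable (ae_of_all _ fun u => ?_)
  rw [Real.norm_of_nonneg (stepDensity_nonneg ht u)]
  exact stepDensity_le ht u

/-- The density of `n + 1` independent steps at positions `v 0, …, v (n - 1), s - ∑ v i`. -/
noncomputable def pathDensity (t : ℝ) (n : ℕ) (s : ℝ) (v : Fin n → ℝ) : ℝ :=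
  (∏ i, stepDensity t (v i)) * stepDensity t (s - ∑ i, v i)

lemma meanDensity_eq_integral_pathDensity (N : ℕ) (t u : ℝ) :
    meanDensity N t u = N * ∫ v, pathDensity (t / N) (N - 1) (N * u) v := rfl

lemma integrable_pathDensity {t : ℝ} (ht : 0 ≤ t) (n : ℕ) (s : ℝ) :
    Integrable (pathDensity t n s) := by
  have h : Integrable (fun v : Fin n → ℝ => ∏ i, stepDensity t (v i)) :=
    Integrable.fintype_prod (f := fun _ => stepDensity t) fun _ => integrable_stepDensity ht
  refine h.mul_bdd (c := Real.exp t) ?_ (ae_of_all _ fun v => ?_)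
  · exact Measurable.aestronglyMeasurable (by fun_prop)
  · rw [Real.norm_of_nonneg (stepDensity_nonneg ht _)]
    refine (stepDensity_le ht _).trans (mul_le_of_le_one_right (Real.exp_pos t).le ?_)
    rw [stepDensity_zero]
    exact indicator_apply_le' (fun _ => by norm_num) (fun _ => by norm_num)

/-- With `t / (n + 1)` in place of `t` the constant becomes `exp t`, independent of `n`; hence the
drift does not affect the exponential rate. -/
lemma pathDensity_le {t : ℝ} (ht : 0 ≤ t) (n : ℕ) (s : ℝ) (v : Fin n → ℝ) :
    pathDensity t n s v ≤ Real.exp ((n + 1) * t) * pathDensity 0 n s v := by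
  have e : Real.exp ((n + 1) * t) = (∏ _i : Fin n, Real.exp t) * Real.exp t := by
    rw [Finset.prod_const, Finset.card_univ, Fintype.card_fin, ← pow_succ, ← Real.exp_nat_mul]
    push_cast; rfl
  rw [e, pathDensity, pathDensity, mul_mul_mul_comm, ← Finset.prod_mul_distrib]
  refine mul_le_mul (Finset.prod_le_prod (fun i _ => stepDensity_nonneg ht _)
    fun i _ => stepDensity_le ht _) (stepDensity_le ht _) (stepDensity_nonneg ht _)
    (Finset.prod_nonneg fun i _ => mul_nonneg (Real.exp_pos _).le (stepDensity_nonneg le_rfl _))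

lemma le_pathDensity {t : ℝ} (ht : 0 ≤ t) (n : ℕ) (s : ℝ) (v : Fin n → ℝ) :
    Real.exp (-((n + 1) * t)) * pathDensity 0 n s v ≤ pathDensity t n s v := by
  have e : Real.exp (-((n + 1) * t)) = (∏ _i : Fin n, Real.exp (-t)) * Real.exp (-t) := by
    rw [Finset.prod_const, Finset.card_univ, Fintype.card_fin, ← pow_succ, ← Real.exp_nat_mul]
    push_cast; ring_nf
  have h0 : ∀ x, 0 ≤ Real.exp (-t) * stepDensity 0 x := fun x =>
    mul_nonneg (Real.exp_pos _).le (stepDensity_nonneg le_rfl _)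
  rw [e, pathDensity, pathDensity, mul_mul_mul_comm, ← Finset.prod_mul_distrib]
  exact mul_le_mul (Finset.prod_le_prod (fun i _ => h0 _) fun i _ => le_stepDensity ht _)
    (le_stepDensity ht _) (h0 _) (Finset.prod_nonneg fun i _ => stepDensity_nonneg ht _)

lemma integral_pathDensity_zero (n : ℕ) :
    ∀ s, ∫ v, pathDensity 0 n s v = (1 / 2) ^ (n + 1) * boxConv n s := by
  induction n with
  | zero =>
    intro s
    rw [integral_unique]
    simp only [pathDensity, boxConv_zero, stepDensity_zero, volume_pi]
    by_cases h : s ∈ Icc (-1 : ℝ) 1 <;> simp [h, measureReal_def]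
  | succ n ih =>
    intro s
    have hp := (volume_preserving_piFinSuccAbove (fun _ : Fin (n + 1) => ℝ) 0).symm
    have hi := integrable_pathDensity le_rfl (n + 1) s
    rw [← hp.integrable_comp_emb (MeasurableEquiv.measurableEmbedding _)] at hi
    rw [← hp.integral_comp (MeasurableEquiv.measurableEmbedding _)]
    change ∫ v, (pathDensity 0 (n + 1) s ∘ _) v = _
    rw [Measure.volume_eq_prod] at hi ⊢
    rw [integral_prod _ hi]
    have e : ∀ (x : ℝ) (v : Fin n → ℝ),
        (pathDensity 0 (n + 1) s ∘
          (MeasurableEquiv.piFinSuccAbove (fun _ : Fin (n + 1) => ℝ) 0).symm) (x, v) =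
        stepDensity 0 x * pathDensity 0 n (s - x) v := by
      intro x v
      simp [pathDensity, MeasurableEquiv.piFinSuccAbove, Fin.prod_univ_succ, Fin.sum_univ_succ,
        Fin.insertNthEquiv, sub_sub, mul_assoc]
    have e2 : ∀ x, ∫ v : Fin n → ℝ, stepDensity 0 x * pathDensity 0 n (s - x) v =
        (Icc (-1 : ℝ) 1).indicator (fun x => (1 / 2) ^ (n + 2) * boxConv n (s - x)) x := by
      intro x
      rw [integral_const_mul, ih, stepDensity_zero]
      by_cases h : x ∈ Icc (-1 : ℝ) 1
      · simp only [indicator_of_mem h]; ring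
      · simp [h]
    calc _ = ∫ x, ∫ v : Fin n → ℝ, stepDensity 0 x * pathDensity 0 n (s - x) v := by
          refine integral_congr_ae (ae_of_all _ fun x => ?_)
          exact integral_congr_ae (ae_of_all _ fun v => e x v)
      _ = _ := by
          simp_rw [e2]
          rw [integral_indicator measurableSet_Icc, integral_Icc_eq_integral_Ioc,
            ← intervalIntegral.integral_of_le (by norm_num), intervalIntegral.integral_const_mul,
            boxConv_succ]

lemma meanDensity_succ_le {t : ℝ} (ht : 0 ≤ t) (n : ℕ) (u : ℝ) :
    meanDensity (n + 1) t u ≤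
      Real.exp t * ((n + 1) * ((1 / 2) ^ (n + 1) * boxConv n ((n + 1) * u))) := by
  have ht' : 0 ≤ t / (n + 1 : ℕ) := by positivity
  have hn : ((n : ℝ) + 1) * (t / (n + 1 : ℕ)) = t := by push_cast; field_simp
  have := integral_mono (integrable_pathDensity ht' n ((n + 1 : ℕ) * u))
    ((integrable_pathDensity le_rfl n ((n + 1 : ℕ) * u)).const_mul _)
    (fun v => pathDensity_le ht' n ((n + 1 : ℕ) * u) v)
  rw [integral_const_mul, hn, integral_pathDensity_zero] at this
  rw [meanDensity_eq_integral_pathDensity, Nat.add_sub_cancel, mul_left_comm]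
  push_cast at this ⊢
  exact mul_le_mul_of_nonneg_left this (by positivity)

lemma le_meanDensity_succ {t : ℝ} (ht : 0 ≤ t) (n : ℕ) (u : ℝ) :
    Real.exp (-t) * ((n + 1) * ((1 / 2) ^ (n + 1) * boxConv n ((n + 1) * u))) ≤
      meanDensity (n + 1) t u := by
  have ht' : 0 ≤ t / (n + 1 : ℕ) := by positivity
  have hn : ((n : ℝ) + 1) * (t / (n + 1 : ℕ)) = t := by push_cast; field_simp
  have := integral_mono ((integrable_pathDensity le_rfl n ((n + 1 : ℕ) * u)).const_mul _)
    (integrable_pathDensity ht' n ((n + 1 : ℕ) * u))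
    (fun v => le_pathDensity ht' n ((n + 1 : ℕ) * u) v)
  rw [integral_const_mul, hn, integral_pathDensity_zero] at this
  rw [meanDensity_eq_integral_pathDensity, Nat.add_sub_cancel, mul_left_comm]
  push_cast at this ⊢
  exact mul_le_mul_of_nonneg_left this (by positivity)

/-! ### Slab volumes of the cube -/

lemma measurableSet_cubeSlab (N : ℕ) (β : ℝ) : MeasurableSet (cubeSlab N β) := by
  apply IsClosed.measurableSet
  have h1 : IsClosed {y : Fin (N - 1) → ℝ | ∀ i, 0 ≤ y i ∧ y i ≤ 1} := by
    rw [ofPred_forall]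
    exact isClosed_iInter fun i => (isClosed_le (by fun_prop) (by fun_prop) :
      IsClosed {y : Fin (N - 1) → ℝ | 0 ≤ y i}).inter (isClosed_le (by fun_prop) (by fun_prop) :
      IsClosed {y : Fin (N - 1) → ℝ | y i ≤ 1})
  exact h1.inter ((isClosed_le (by fun_prop) (by fun_prop) :
    IsClosed {y : Fin (N - 1) → ℝ | β * N - 1 ≤ ∑ i, y i}).inter
    (isClosed_le (by fun_prop) (by fun_prop) :
    IsClosed {y : Fin (N - 1) → ℝ | ∑ i, y i ≤ β * N}))

/-- The substitution `v = 1 - 2 y` takes the cube `[0, 1]^n` to `[-1, 1]^n`, and the constraint on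
the last step becomes the pair of slab inequalities. -/
lemma pathDensity_zero_one_sub (n : ℕ) (u : ℝ) (y : Fin n → ℝ) :
    pathDensity 0 n ((n + 1) * u) ((fun _ => 1) - (2 : ℝ) • y) =
      (cubeSlab (n + 1) ((1 - u) / 2)).indicator (fun _ => (1 / 2) ^ (n + 1)) y := by
  have hmem : ∀ x : ℝ, 1 - 2 * x ∈ Icc (-1 : ℝ) 1 ↔ 0 ≤ x ∧ x ≤ 1 := fun x =>
    ⟨fun h => ⟨by linarith [h.2], by linarith [h.1]⟩,
      fun h => ⟨by linarith [h.2], by linarith [h.1]⟩⟩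
  have hsum : ∑ i, ((fun _ => 1) - (2 : ℝ) • y : Fin n → ℝ) i = n - 2 * ∑ i, y i := by
    simp [Finset.sum_sub_distrib, Finset.mul_sum]
  have hlast : (n + 1) * u - (n - 2 * ∑ i, y i) ∈ Icc (-1 : ℝ) 1 ↔
      (1 - u) / 2 * (n + 1 : ℕ) - 1 ≤ ∑ i, y i ∧ ∑ i, y i ≤ (1 - u) / 2 * (n + 1 : ℕ) := by
    push_cast
    exact ⟨fun h => ⟨by linarith [h.1], by linarith [h.2]⟩,
      fun h => ⟨by linarith [h.1], by linarith [h.2]⟩⟩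
  rw [pathDensity, hsum]
  simp only [stepDensity_zero, Pi.sub_apply, Pi.smul_apply, smul_eq_mul]
  by_cases hy : ∀ i, 0 ≤ y i ∧ y i ≤ 1
  · rw [Finset.prod_congr rfl fun i _ => indicator_of_mem ((hmem _).2 (hy i)) _,
      Finset.prod_const, Finset.card_univ, Fintype.card_fin, pow_succ]
    by_cases hl : (n + 1) * u - (n - 2 * ∑ i, y i) ∈ Icc (-1 : ℝ) 1
    · rw [indicator_of_mem hl, indicator_of_mem]
      exact ⟨hy, hlast.1 hl⟩
    · rw [indicator_of_notMem hl, indicator_of_notMem, mul_zero]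
      exact fun h => hl (hlast.2 h.2)
  · rw [indicator_of_notMem (s := cubeSlab (n + 1) ((1 - u) / 2)) fun h => hy h.1]
    push Not at hy
    obtain ⟨i, hi⟩ := hy
    rw [Finset.prod_eq_zero (Finset.mem_univ i), zero_mul]
    refine indicator_of_notMem (fun h => ?_) _
    have := (hmem _).1 h
    exact absurd (hi this.1) (not_lt.2 this.2)

/-- The Jacobian `2 ^ n` against the density `(1 / 2) ^ (n + 1)` leaves the factor `1 / 2`. -/
lemma meanDensity_zero_eq_cubeSlab (N : ℕ) (hN : 1 ≤ N) (u : ℝ) :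
    meanDensity N 0 u = N / 2 * volume.real (cubeSlab N ((1 - u) / 2)) := by
  obtain ⟨n, rfl⟩ := Nat.exists_eq_add_of_le' hN
  rw [meanDensity_eq_integral_pathDensity, zero_div]
  have h1 := integral_sub_left_eq_self (pathDensity 0 n ((n + 1) * u)) volume
    (fun _ : Fin n => (1 : ℝ))
  have h2 := Measure.integral_comp_smul (volume : Measure (Fin n → ℝ))
    (fun v => pathDensity 0 n ((n + 1) * u) ((fun _ => 1) - v)) 2
  simp_rw [pathDensity_zero_one_sub] at h2
  have h0 : ∫ y : Fin n → ℝ, (cubeSlab (n + 1) ((1 - u) / 2)).indicator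
      (fun _ => (1 / 2 : ℝ) ^ (n + 1)) y =
      volume.real (cubeSlab (n + 1) ((1 - u) / 2)) • (1 / 2) ^ (n + 1) :=
    integral_indicator_const _ (measurableSet_cubeSlab (n + 1) _)
  rw [h1, h0, Module.finrank_fin_fun,
    smul_eq_mul, smul_eq_mul, abs_of_pos (by positivity), ← one_div] at h2
  change (n + 1 : ℕ) * ∫ v : Fin n → ℝ, pathDensity 0 n ((n + 1 : ℕ) * u) v = _
  push_cast
  have h3 : ∫ v, pathDensity 0 n ((n + 1) * u) v =
      1 / 2 * volume.real (cubeSlab (n + 1) ((1 - u) / 2)) := by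
    have h4 : (2 : ℝ) ^ n ≠ 0 := by positivity
    rw [one_div_pow, pow_succ, one_div, one_div] at h2
    field_simp at h2
    rw [mul_comm ((n : ℝ) + 1) u]
    linarith
  rw [h3]; ring

/-! ### The parametrization of `(-1, 1)` -/

lemma uParam_neg (y : ℝ) : uParam (-y) = -uParam y := by
  by_cases h : y = 0
  · simp [h, uParam]
  · simp only [uParam, neg_eq_zero, if_neg h, Real.cosh_neg, Real.sinh_neg, div_neg]; ring

lemma logSinhc_neg (y : ℝ) : logSinhc (-y) = logSinhc y := by
  simp [logSinhc]

lemma uParam_zero : uParam 0 = 0 := by simp [uParam]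

lemma logSinhc_zero : logSinhc 0 = 0 := by simp [logSinhc]

lemma sinh_ne_zero {y : ℝ} (h : y ≠ 0) : Real.sinh y ≠ 0 := by
  simpa [Real.sinh_eq_zero] using h

lemma hasDerivAt_uParam {y : ℝ} (h : y ≠ 0) :
    HasDerivAt uParam (1 / Real.sinh y ^ 2 - 1 / y ^ 2) y := by
  have hs := sinh_ne_zero h
  have e : (fun y => 1 / y - Real.cosh y / Real.sinh y) =ᶠ[𝓝 y] uParam := by
    filter_upwards [isOpen_ne.mem_nhds h] with x hx
    simp only [uParam, if_neg (show x ≠ 0 from hx)]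
  refine HasDerivAt.congr_of_eventuallyEq ?_ e.symm
  have h1 : HasDerivAt (fun y : ℝ => 1 / y) (-(y ^ 2)⁻¹) y := by
    simpa using hasDerivAt_inv h
  refine (h1.sub ((Real.hasDerivAt_cosh y).div (Real.hasDerivAt_sinh y) hs)).congr_deriv ?_
  have := Real.cosh_sq y
  field_simp
  rw [this]; ring

/-- A crude bound whose only purpose is continuity at `0`, where the formula is singular. -/
lemma abs_uParam_le (y : ℝ) (hy : 0 < y) : |uParam y| ≤ Real.sinh y := by
  have hs : 0 < Real.sinh y := Real.sinh_pos_iff.2 hy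
  have hle : y ≤ Real.sinh y := Real.self_le_sinh_iff.2 hy.le
  have hsq := Real.cosh_sq y
  have hc := Real.one_le_cosh y
  simp only [uParam, if_neg hy.ne']
  have e : 1 / y - Real.cosh y / Real.sinh y = (Real.sinh y - y * Real.cosh y) /
      (y * Real.sinh y) := by field_simp
  rw [e, abs_div, abs_of_pos (mul_pos hy hs), div_le_iff₀ (mul_pos hy hs), abs_le]
  have h1 : Real.cosh y - 1 ≤ Real.sinh y ^ 2 := by nlinarith
  have h2 : y * (Real.cosh y - 1) ≤ y * Real.sinh y ^ 2 := mul_le_mul_of_nonneg_left h1 hy.le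
  have hd : ∀ x ∈ Ici (0 : ℝ), x * Real.cosh x - Real.sinh x ≥ 0 := by
    have hm : MonotoneOn (fun x => x * Real.cosh x - Real.sinh x) (Ici 0) := by
      apply monotoneOn_of_deriv_nonneg (convex_Ici 0) (by fun_prop) (by fun_prop)
      intro x hx
      rw [interior_Ici, mem_Ioi] at hx
      have : HasDerivAt (fun x => x * Real.cosh x - Real.sinh x)
          (1 * Real.cosh x + x * Real.sinh x - Real.cosh x) x :=
        ((hasDerivAt_id x).mul (Real.hasDerivAt_cosh x)).sub (Real.hasDerivAt_sinh x)
      rw [this.deriv]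
      have := mul_pos hx (Real.sinh_pos_iff.2 hx)
      linarith
    intro x hx
    simpa using hm self_mem_Ici hx hx
  have h3 := hd y hy.le
  have h4 : 0 ≤ Real.sinh y * (y * Real.sinh y) := by positivity
  constructor <;> nlinarith

lemma continuous_uParam : Continuous uParam := by
  rw [continuous_iff_continuousAt]
  intro y
  by_cases h : y = 0
  · rw [h, ContinuousAt, uParam_zero]
    have hb : ∀ x, |uParam x| ≤ |Real.sinh x| := by
      intro x
      rcases lt_trichotomy x 0 with hx | hx | hx
      · have := abs_uParam_le (-x) (by linarith)
        rw [uParam_neg, abs_neg] at this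
        refine this.trans ?_
        rw [Real.sinh_neg]; exact neg_le_abs _
      · simp [hx, uParam_zero]
      · exact (abs_uParam_le x hx).trans (le_abs_self _)
    refine squeeze_zero_norm hb ?_
    have : ContinuousAt (fun x => |Real.sinh x|) 0 := by fun_prop
    simpa [ContinuousAt] using this
  · exact (hasDerivAt_uParam h).continuousAt

lemma strictAnti_uParam : StrictAnti uParam := by
  have h1 : StrictAntiOn uParam (Ici 0) := by
    apply strictAntiOn_of_deriv_neg (convex_Ici 0) continuous_uParam.continuousOn
    intro x hx
    rw [interior_Ici, mem_Ioi] at hx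
    rw [(hasDerivAt_uParam hx.ne').deriv, sub_neg]
    have := Real.self_lt_sinh_iff.2 hx
    gcongr
  refine StrictAntiOn.Iic_union_Ici (a := 0) ?_ h1
  intro a ha b hb hab
  have := h1 (show -b ∈ Ici 0 by simpa using hb) (show -a ∈ Ici 0 by simpa using ha)
    (by linarith)
  rw [uParam_neg, uParam_neg] at this
  linarith

lemma tendsto_uParam_atTop : Tendsto uParam atTop (𝓝 (-1)) := by
  have h1 : Tendsto (fun y : ℝ => 1 / y) atTop (𝓝 0) := by
    simpa using tendsto_inv_atTop_zero (𝕜 := ℝ)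
  have h2 : Tendsto (fun y : ℝ => Real.exp (-(2 * y))) atTop (𝓝 0) :=
    Real.tendsto_exp_neg_atTop_nhds_zero.comp (tendsto_id.const_mul_atTop two_pos)
  have h3 : Tendsto (fun y : ℝ => 1 / y - (1 + Real.exp (-(2 * y))) / (1 - Real.exp (-(2 * y))))
      atTop (𝓝 (0 - (1 + 0) / (1 - 0))) :=
    h1.sub ((h2.const_add 1).div (h2.const_sub 1) (by norm_num))
  norm_num at h3
  refine h3.congr' ?_
  filter_upwards [eventually_gt_atTop 0] with y hy
  simp only [uParam, if_neg hy.ne', one_div]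
  congr 1
  have e : Real.exp (-(2 * y)) = Real.exp (-y) / Real.exp y := by
    rw [← Real.exp_sub]; ring_nf
  have hs : Real.exp y - Real.exp (-y) ≠ 0 :=
    (sub_pos.2 (Real.exp_lt_exp.2 (by linarith))).ne'
  rw [e, Real.cosh_eq, Real.sinh_eq]
  field_simp

lemma tendsto_uParam_atBot : Tendsto uParam atBot (𝓝 1) := by
  have := (tendsto_uParam_atTop.comp tendsto_neg_atBot_atTop).neg
  simpa [Function.comp_def, uParam_neg] using this

lemma uParam_mem (y : ℝ) : uParam y ∈ Ioo (-1 : ℝ) 1 := by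
  constructor
  · exact (strictAnti_uParam.antitone.le_of_tendsto tendsto_uParam_atTop (y + 1)).trans_lt
      (strictAnti_uParam (by linarith))
  · exact (strictAnti_uParam (by linarith : y - 1 < y)).trans_le
      (strictAnti_uParam.antitone.ge_of_tendsto tendsto_uParam_atBot (y - 1))

lemma exists_uParam_eq {u : ℝ} (hu : u ∈ Ioo (-1 : ℝ) 1) : ∃ y, uParam y = u := by
  obtain ⟨a, ha⟩ := (tendsto_uParam_atTop.eventually (gt_mem_nhds hu.1)).exists
  obtain ⟨b, hb⟩ := (tendsto_uParam_atBot.eventually (lt_mem_nhds hu.2)).exists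
  exact mem_range_of_exists_le_of_exists_ge continuous_uParam ⟨a, ha.le⟩ ⟨b, hb.le⟩

lemma abs_uParam_lt_one (y : ℝ) : |uParam y| < 1 := abs_lt.2 (uParam_mem y)

lemma bijOn_uParam : BijOn uParam univ (Ioo (-1) 1) :=
  ⟨fun y _ => uParam_mem y, strictAnti_uParam.injective.injOn, fun _ hu =>
    let ⟨y, hy⟩ := exists_uParam_eq hu; ⟨y, mem_univ y, hy⟩⟩

/-! ### Legendre duality -/

/-- The tangent line inequality for the convex function `logSinhc`, whose derivative is `-uParam`. -/
lemma logSinhc_sub_le (p q : ℝ) : logSinhc p - uParam p * (q - p) ≤ logSinhc q := by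
  -- Integrate `1 + a ≤ exp a` with `a = -((q - p) * (x - uParam p))` against the law tilted by `p`;
  -- the linear term has mean zero.
  have hint := intervalIntegral.integral_mono_on (by norm_num : (-1 : ℝ) ≤ 1)
    (f := fun x => Real.exp (-((q - p) * uParam p)) * (1 + (q - p) * uParam p) *
        Real.exp (-(p * x)) -
      Real.exp (-((q - p) * uParam p)) * (q - p) * (x * Real.exp (-(p * x))))
    (g := fun x => Real.exp (-(q * x))) (μ := volume)
    (by apply Continuous.intervalIntegrable; fun_prop)
    (by apply Continuous.intervalIntegrable; fun_prop) (fun x _ => by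
      have h1 := Real.add_one_le_exp (-((q - p) * (x - uParam p)))
      have h2 : Real.exp (-(q * x)) = Real.exp (-((q - p) * uParam p)) * Real.exp (-(p * x)) *
          Real.exp (-((q - p) * (x - uParam p))) := by
        rw [← Real.exp_add, ← Real.exp_add]; ring_nf
      rw [h2]
      have := mul_le_mul_of_nonneg_left h1 (by positivity :
        0 ≤ Real.exp (-((q - p) * uParam p)) * Real.exp (-(p * x)))
      refine le_trans (le_of_eq ?_) this
      ring)
  rw [intervalIntegral.integral_sub (by apply Continuous.intervalIntegrable; fun_prop)
    (by apply Continuous.intervalIntegrable; fun_prop), intervalIntegral.integral_const_mul,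
    intervalIntegral.integral_const_mul, integral_exp_neg_mul_box, integral_exp_neg_mul_box,
    integral_mul_exp_neg_mul_box] at hint
  have h3 : Real.exp (-((q - p) * uParam p)) * Real.exp (logSinhc p) ≤
      Real.exp (logSinhc q) := by linarith
  rw [← Real.exp_add, Real.exp_le_exp] at h3
  linarith

lemma uParam_mul_add_logSinhc_le (p q : ℝ) :
    uParam p * p + logSinhc p ≤ uParam p * q + logSinhc q := by
  have := logSinhc_sub_le p q
  linarith

/-- The logarithmic gain over `s` is what drives the exponent to `-∞` at `±1`. -/
lemma logSinhc_le {s : ℝ} (hs : 0 < s) : logSinhc s ≤ s - Real.log (2 * s) := by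
  have h1 : Real.sinh s ≤ Real.exp s / 2 := by
    rw [Real.sinh_eq]; linarith [Real.exp_pos (-s)]
  rw [logSinhc, if_neg hs.ne', Real.log_le_iff_le_exp (div_pos (Real.sinh_pos_iff.2 hs) hs),
    Real.exp_sub, Real.exp_log (by linarith), div_le_div_iff₀ hs (by linarith)]
  have := mul_le_mul_of_nonneg_right h1 (by linarith : 0 ≤ 2 * s)
  linarith

/-- The Legendre transform of `logSinhc` is differentiable, with the parameter as derivative. -/
lemma hasDerivAt_of_legendre {G : ℝ → ℝ} (hG : ∀ y, G (uParam y) = uParam y * y + logSinhc y)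
    (y : ℝ) : HasDerivAt G y (uParam y) := by
  rw [hasDerivAt_iff_isLittleO, isLittleO_iff]
  intro ε hε
  have hmem : Ioo (uParam (y + ε)) (uParam (y - ε)) ∈ 𝓝 (uParam y) :=
    Ioo_mem_nhds (strictAnti_uParam (by linarith)) (strictAnti_uParam (by linarith))
  filter_upwards [hmem] with v hv
  obtain ⟨q, rfl⟩ := exists_uParam_eq
    (u := v) ⟨(uParam_mem _).1.trans hv.1, hv.2.trans (uParam_mem _).2⟩
  have h1 := strictAnti_uParam.lt_iff_gt.1 hv.1
  have h2 := strictAnti_uParam.lt_iff_gt.1 hv.2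
  -- Each parameter is a competitor in the other's minimization; the two inequalities trap the
  -- Taylor remainder between `0` and `(q - y) * (uParam q - uParam y)`.
  have h3 := uParam_mul_add_logSinhc_le q y
  have h4 := uParam_mul_add_logSinhc_le y q
  rw [hG, hG, smul_eq_mul, Real.norm_eq_abs, Real.norm_eq_abs]
  have h5 : |q - y| ≤ ε := abs_le.2 ⟨by linarith, by linarith⟩
  calc |uParam q * q + logSinhc q - (uParam y * y + logSinhc y) - (uParam q - uParam y) * y|
      ≤ |(q - y) * (uParam q - uParam y)| := by
        rw [abs_le]
        have := neg_abs_le ((q - y) * (uParam q - uParam y))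
        have := abs_nonneg ((q - y) * (uParam q - uParam y))
        constructor <;> linarith
    _ = |q - y| * |uParam q - uParam y| := abs_mul _ _
    _ ≤ _ := by gcongr

/-! ### Singular solutions of the Clairaut equation -/

/-- On an interval where the derivative of a Clairaut solution stays on one side of the singular
value, the solution is affine. -/
lemma clairaut_deriv_eq_of_lt {g p : ℝ → ℝ} {a b : ℝ}
    (hg : ∀ u ∈ Ioo a b, HasDerivAt g (p u) u)
    (hc : ∀ u ∈ Ioo a b, g u = u * p u + logSinhc (p u))
    (hlt : ∀ u ∈ Ioo a b, uParam (p u) < u) :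
    ∀ u ∈ Ioo a b, ∀ v ∈ Ioo a b, p u = p v := by
  -- No second derivative of `g` is available. By the equation, the first-order remainder of `g` at
  -- `u` is the increment of the convex function `s ↦ v * s + logSinhc s` from `p u` to `p v`. For
  -- `v` near `u` its slope is at least `m` on `s ≥ q`, so `p v - p u` is `o(v - u)`.
  have key : ∀ u ∈ Ioo a b, HasDerivAt p 0 u := by
    intro u hu
    obtain ⟨q, hqp, hqu⟩ : ∃ q < p u, uParam q < u := by
      have h1 : ∀ᶠ q in 𝓝[<] (p u), uParam q < u :=
        (continuous_uParam.continuousAt.eventually (gt_mem_nhds (hlt u hu))).filter_mono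
          nhdsWithin_le_nhds
      obtain ⟨q, hq1, hq2⟩ := (h1.and self_mem_nhdsWithin).exists
      exact ⟨q, hq2, hq1⟩
    set m := (u - uParam q) / 2 with hm
    have hm0 : 0 < m := by rw [hm]; linarith
    have hE := (hasDerivAt_iff_isLittleO.1 (hg u hu))
    have hsmall : ∀ᶠ v in 𝓝 u, |g v - g u - (v - u) * p u| < m * (p u - q) := by
      have hcont : ContinuousAt (fun v => |g v - g u - (v - u) * p u|) u := by
        have := (hg u hu).continuousAt
        fun_prop
      refine hcont.eventually (gt_mem_nhds ?_)
      simp only [sub_self, zero_mul, abs_zero]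
      exact mul_pos hm0 (by linarith)
    have hbound : ∀ᶠ v in 𝓝 u, m * |p v - p u| ≤ |g v - g u - (v - u) * p u| := by
      filter_upwards [hsmall, Ioo_mem_nhds hu.1 hu.2,
        lt_mem_nhds (show uParam q + m < u by rw [hm]; linarith)] with v hv hvJ hvm
      have e : g v - g u - (v - u) * p u =
          (v * p v + logSinhc (p v)) - (v * p u + logSinhc (p u)) := by
        rw [hc v hvJ, hc u hu]; ring
      have slope : ∀ r s : ℝ, r ≤ s → uParam r ≤ uParam q →
          m * (s - r) ≤ (v * s + logSinhc s) - (v * r + logSinhc r) := by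
        intro r s hrs hr
        have h1 := logSinhc_sub_le r s
        have h2 : m * (s - r) ≤ (v - uParam r) * (s - r) :=
          mul_le_mul_of_nonneg_right (by linarith) (by linarith)
        linarith
      rw [e] at hv ⊢
      rcases le_total (p u) (p v) with h | h
      · rw [abs_of_nonneg (sub_nonneg.2 h)]
        exact (slope _ _ h (strictAnti_uParam.antitone hqp.le)).trans (le_abs_self _)
      · rcases le_total q (p v) with h' | h'
        · rw [abs_of_nonpos (sub_nonpos.2 h)]
          have := slope _ _ h (strictAnti_uParam.antitone h')
          refine le_trans ?_ (neg_le_abs _)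
          linarith
        -- Since `p` is not known to be continuous, a jump of `p v` below `q` must be excluded. The
        -- convex function increases from `p v` on, so the increment up to `p u` would be at least
        -- `m * (p u - q)`, against smallness of the remainder.
        · exfalso
          have h1 := slope _ _ hqp.le le_rfl
          have h2 := logSinhc_sub_le (p v) q
          have h3 : 0 ≤ (v - uParam (p v)) * (q - p v) :=
            mul_nonneg (by linarith [hlt v hvJ]) (by linarith)
          have h4 := neg_le_abs ((v * p v + logSinhc (p v)) - (v * p u + logSinhc (p u)))
          linarith
    rw [hasDerivAt_iff_isLittleO]
    refine IsBigO.trans_isLittleO (g := fun v => g v - g u - (v - u) * p u)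
      (IsBigO.of_bound m⁻¹ ?_) hE
    filter_upwards [hbound] with v hv
    rw [smul_zero, sub_zero, Real.norm_eq_abs, Real.norm_eq_abs, inv_mul_eq_div,
      le_div_iff₀ hm0, mul_comm]
    exact hv
  intro u hu v hv
  exact isOpen_Ioo.is_const_of_deriv_eq_zero isPreconnected_Ioo
    (fun x hx => (key x hx).differentiableAt.differentiableWithinAt)
    (fun x hx => (key x hx).deriv) hu hv

lemma clairaut_deriv_eq_of_gt {g p : ℝ → ℝ} {a b : ℝ}
    (hg : ∀ u ∈ Ioo a b, HasDerivAt g (p u) u)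
    (hc : ∀ u ∈ Ioo a b, g u = u * p u + logSinhc (p u))
    (hlt : ∀ u ∈ Ioo a b, u < uParam (p u)) :
    ∀ u ∈ Ioo a b, ∀ v ∈ Ioo a b, p u = p v := by
  have hneg : ∀ {u}, u ∈ Ioo (-b) (-a) → -u ∈ Ioo a b := fun hu =>
    ⟨by linarith [hu.2], by linarith [hu.1]⟩
  have := clairaut_deriv_eq_of_lt (g := fun u => g (-u)) (p := fun u => -p (-u)) (a := -b) (b := -a)
    (fun u hu => by
      have h := (hg (-u) (hneg hu)).comp u (hasDerivAt_neg u)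
      simpa [Function.comp_def] using h)
    (fun u hu => by
      rw [hc (-u) (hneg hu), logSinhc_neg]; ring)
    (fun u hu => by
      rw [uParam_neg]; linarith [hlt (-u) (hneg hu)])
  intro u hu v hv
  have h := this (-u) ⟨by linarith [hu.2], by linarith [hu.1]⟩ (-v)
    ⟨by linarith [hv.2], by linarith [hv.1]⟩
  simpa using h

/-- Coincidence with a line of slope `C` near `u` would make `C` the parameter of every nearby
point, yet it is the parameter of `uParam C` alone. -/
lemma isSingularClairautSolution_legendre {G : ℝ → ℝ}
    (hG : ∀ y, G (uParam y) = uParam y * y + logSinhc y) :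
    IsSingularClairautSolution logSinhc G (Ioo (-1) 1) := by
  constructor
  · intro u hu
    obtain ⟨y, rfl⟩ := exists_uParam_eq hu
    have h := hasDerivAt_of_legendre hG y
    exact ⟨h.differentiableAt, by rw [h.deriv, hG]⟩
  · intro u hu C hC
    have h1 : ∀ᶠ v in 𝓝 u, v = uParam C := by
      filter_upwards [hC.eventually_nhds, isOpen_Ioo.mem_nhds hu] with v hv hvI
      obtain ⟨y, rfl⟩ := exists_uParam_eq hvI
      have hv' : (fun v => C * v + logSinhc C) =ᶠ[𝓝 (uParam y)] G := EventuallyEq.symm hv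
      have h2 := (hasDerivAt_of_legendre hG y).congr_of_eventuallyEq hv'
      have h3 : HasDerivAt (fun v => C * v + logSinhc C) (C * 1) (uParam y) :=
        ((hasDerivAt_id _).const_mul C).add_const _
      rw [h2.unique h3, mul_one]
    obtain ⟨v, hv, hne⟩ := ((h1.filter_mono nhdsWithin_le_nhds).and
      (self_mem_nhdsWithin : {u}ᶜ ∈ 𝓝[≠] u)).exists
    exact hne (hv.trans h1.self_of_nhds.symm)

lemma eqOn_legendre_of_isSingularClairautSolution {G g : ℝ → ℝ}
    (hG : ∀ y, G (uParam y) = uParam y * y + logSinhc y)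
    (hg : IsSingularClairautSolution logSinhc g (Ioo (-1) 1)) : EqOn g G (Ioo (-1) 1) := by
  by_contra hne
  simp only [EqOn, not_forall] at hne
  obtain ⟨u, hu, hgu⟩ := hne
  have hdG : ∀ v ∈ Ioo (-1 : ℝ) 1, HasDerivAt G (deriv G v) v ∧ uParam (deriv G v) = v := by
    intro v hv
    obtain ⟨y, rfl⟩ := exists_uParam_eq hv
    have h := hasDerivAt_of_legendre hG y
    rw [h.deriv]; exact ⟨h, rfl⟩
  have hdg : ∀ v ∈ Ioo (-1 : ℝ) 1, HasDerivAt g (deriv g v) v := fun v hv =>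
    (hg.1 v hv).1.hasDerivAt
  have hev : ∀ᶠ v in 𝓝 u, g v - G v ≠ 0 ∧ v ∈ Ioo (-1 : ℝ) 1 :=
    (((hdg u hu).continuousAt.sub (hdG u hu).1.continuousAt).eventually_ne
      (sub_ne_zero.2 hgu)).and (isOpen_Ioo.mem_nhds hu)
  obtain ⟨a, b, hab, hsub⟩ := mem_nhds_iff_exists_Ioo_subset.1 hev
  -- Equal derivatives would give equal values through the equation.
  have hp : ∀ v ∈ Ioo a b, deriv g v - deriv G v ≠ 0 := by
    intro v hv h0
    obtain ⟨hne, hvI⟩ := hsub hv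
    apply hne
    obtain ⟨y, rfl⟩ := exists_uParam_eq hvI
    have hy : deriv g (uParam y) = y := by
      have := (hasDerivAt_of_legendre hG y).deriv
      linarith
    rw [(hg.1 _ hvI).2, hy, hG, sub_self]
  have hconst : ∀ v ∈ Ioo a b, ∀ w ∈ Ioo a b, deriv g v = deriv g w := by
    -- Darboux's property: a nowhere vanishing derivative has constant sign, without continuity of
    -- `deriv g`.
    rcases hasDerivWithinAt_forall_lt_or_forall_gt_of_forall_ne (convex_Ioo a b)
      (f := fun v => g v - G v)
      (fun v hv => ((hdg v (hsub hv).2).sub (hdG v (hsub hv).2).1).hasDerivWithinAt) hp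
      with h | h
    · refine clairaut_deriv_eq_of_gt (fun v hv => hdg v (hsub hv).2)
        (fun v hv => (hg.1 v (hsub hv).2).2) fun v hv => ?_
      have := strictAnti_uParam (sub_neg.1 (h v hv))
      rwa [(hdG v (hsub hv).2).2] at this
    · refine clairaut_deriv_eq_of_lt (fun v hv => hdg v (hsub hv).2)
        (fun v hv => (hg.1 v (hsub hv).2).2) fun v hv => ?_
      have := strictAnti_uParam (sub_pos.1 (h v hv))
      rwa [(hdG v (hsub hv).2).2] at this
  refine hg.2 u hu (deriv g u) ?_
  filter_upwards [Ioo_mem_nhds hab.1 hab.2] with v hv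
  rw [(hg.1 v (hsub hv).2).2, hconst v hv u hab, mul_comm]

/-! ### The parametrization by `z = exp (-2 y)` -/

lemma polyBeta_exp {y : ℝ} (hy : y ≠ 0) : polyBeta (Real.exp (-2 * y)) = (1 - uParam y) / 2 := by
  have e : Real.exp (-2 * y) = Real.exp (-y) / Real.exp y := by
    rw [← Real.exp_sub]; ring_nf
  have hs := sinh_ne_zero hy
  rw [Real.sinh_eq] at hs
  have hs' : Real.exp y - Real.exp (-y) ≠ 0 := fun h => hs (by rw [h]; simp)
  rw [polyBeta, Real.log_exp, uParam, if_neg hy, e, Real.cosh_eq, Real.sinh_eq]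
  field_simp
  ring

lemma polyRate_exp {y : ℝ} (hy : y ≠ 0) :
    polyRate (Real.exp (-2 * y)) = Real.exp (uParam y * y + logSinhc y) := by
  have hs := sinh_ne_zero hy
  have hb := polyBeta_exp hy
  rw [polyBeta, Real.log_exp] at hb
  have hpos : 0 < Real.sinh y / y := by
    rcases lt_or_gt_of_ne hy with h' | h'
    · exact div_pos_of_neg_of_neg (Real.sinh_neg_iff.2 h') h'
    · exact div_pos (Real.sinh_pos_iff.2 h') h'
  have hz : 1 - Real.exp (-2 * y) ≠ 0 := by
    rw [sub_ne_zero]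
    intro h
    exact hy (by simpa using (Real.exp_eq_one_iff _).1 h.symm)
  -- The exponent is `z / (1 - z) = 1 / (1 - z) - 1`, and `1 / (1 - z)` is known from the formula
  -- for `β`.
  have e1 : Real.exp (-2 * y) / (1 - Real.exp (-2 * y)) =
      (1 - uParam y) / 2 - 1 / (-2 * y) - 1 := by
    rw [← hb]
    generalize Real.exp (-2 * y) = E at hz ⊢
    field_simp
    ring
  rw [polyRate, Real.log_exp, e1, ← Real.exp_mul, Real.exp_add, logSinhc, if_neg hy,
    Real.exp_log hpos]
  have e2 : -2 * y * ((1 - uParam y) / 2 - 1 / (-2 * y) - 1) = uParam y * y + y - 1 := by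
    field_simp; ring
  have e3 : Real.exp (-2 * y) = Real.exp (-y) / Real.exp y := by
    rw [← Real.exp_sub]; ring_nf
  rw [e2, Real.exp_sub, Real.exp_add, Real.sinh_eq, e3]
  field_simp
  ring

/-! ### Exponential rate of the mean density -/

lemma boxConv_endpoint {n : ℕ} (hn : 1 ≤ n) {x : ℝ} (hx : x = 1 ∨ x = -1) :
    boxConv n ((n + 1) * x) = 0 := by
  refine le_antisymm ?_ (boxConv_nonneg _ _)
  -- Chernoff's bound with tilt `-(s * x)` gives at most `s⁻¹ ^ n`, and `s` is arbitrarily large.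
  refine ge_of_tendsto (tendsto_inv_atTop_zero (𝕜 := ℝ)) ?_
  filter_upwards [eventually_ge_atTop 1] with s hs
  have hs0 : 0 < s := by linarith
  have habs : |-(s * x)| = s := by
    rcases hx with rfl | rfl <;> simp [abs_of_pos hs0]
  have hlog : logSinhc (-(s * x)) = logSinhc s := by
    rcases hx with rfl | rfl <;> simp [logSinhc_neg]
  have hxx : x * x = 1 := by rcases hx with rfl | rfl <;> norm_num
  have h1 := boxConv_le (-(s * x)) n ((n + 1) * x)
  rw [habs, hlog] at h1
  have e1 : -(s * x) * ((n + 1) * x) = n * (-s) - s := by linear_combination (-(s * (n + 1))) * hxx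
  have h2 : 2 * Real.exp (logSinhc s) ≤ Real.exp s * s⁻¹ := by
    have := Real.exp_le_exp.2 (logSinhc_le hs0)
    rw [Real.exp_sub, Real.exp_log (by linarith)] at this
    calc 2 * Real.exp (logSinhc s) ≤ 2 * (Real.exp s / (2 * s)) := by linarith
      _ = _ := by field_simp
  calc _ ≤ Real.exp s * Real.exp (-(s * x) * ((n + 1) * x)) * (2 * Real.exp (logSinhc s)) ^ n := h1
    _ ≤ Real.exp s * Real.exp (-(s * x) * ((n + 1) * x)) * (Real.exp s * s⁻¹) ^ n := by gcongr
    _ = s⁻¹ ^ n := by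
        rw [e1, Real.exp_sub, Real.exp_nat_mul, mul_div_cancel₀ _ (Real.exp_pos s).ne', ← mul_pow,
          ← mul_assoc, ← Real.exp_add, neg_add_cancel, Real.exp_zero, one_mul]
    _ ≤ s⁻¹ := pow_le_of_le_one (by positivity) (inv_le_one_of_one_le₀ hs) (by omega)

lemma meanDensity_endpoint {t : ℝ} (ht : 0 ≤ t) {N : ℕ} (hN : 2 ≤ N) {x : ℝ}
    (hx : x = 1 ∨ x = -1) : meanDensity N t x = 0 := by
  obtain ⟨n, rfl⟩ := Nat.exists_eq_add_of_le' (by omega : 1 ≤ N)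
  have h1 := meanDensity_succ_le ht n x
  have h2 := le_meanDensity_succ ht n x
  rw [boxConv_endpoint (by omega) hx] at h1 h2
  simp only [mul_zero] at h1 h2
  exact le_antisymm h1 h2

lemma log_meanDensity_succ_le {t : ℝ} (ht : 0 ≤ t) (y : ℝ) (n : ℕ)
    (hpos : 0 < meanDensity (n + 1) t (uParam y)) :
    Real.log (meanDensity (n + 1) t (uParam y)) ≤
      t + |y| - logSinhc y - Real.log 2 + Real.log (n + 1) +
        (n + 1) * (uParam y * y + logSinhc y) := by
  rw [Real.log_le_iff_le_exp hpos]
  refine (meanDensity_succ_le ht n _).trans ?_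
  have h := boxConv_le y n ((n + 1) * uParam y)
  calc _ ≤ Real.exp t * ((n + 1) * ((1 / 2) ^ (n + 1) * (Real.exp |y| *
        Real.exp (y * ((n + 1) * uParam y)) * (2 * Real.exp (logSinhc y)) ^ n))) := by gcongr
    _ = _ := by
      have e : t + |y| - logSinhc y - Real.log 2 + Real.log (n + 1) +
        (n + 1) * (uParam y * y + logSinhc y) =
        t + |y| - Real.log 2 + Real.log (n + 1) + y * ((n + 1) * uParam y) + n * logSinhc y := by
        ring
      rw [e, Real.exp_add, Real.exp_add, Real.exp_add, Real.exp_sub, Real.exp_add,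
        Real.exp_log (by positivity), Real.exp_log (by positivity), Real.exp_nat_mul, mul_pow,
        one_div_pow, pow_succ]
      field_simp

lemma exists_le_log_meanDensity_succ {t : ℝ} (ht : 0 ≤ t) (y : ℝ) {ε : ℝ} (hε : 0 < ε) :
    ∃ K : ℝ, ∀ᶠ n : ℕ in atTop, 0 < meanDensity (n + 1) t (uParam y) ∧
      K - (n + 1) * ε + (n + 1) * (uParam y * y + logSinhc y) ≤
        Real.log (meanDensity (n + 1) t (uParam y)) := by
  -- With this `δ` the loss factor `1 - δ` per step is `exp (-ε)`.
  have hδ : 0 < 1 - Real.exp (-ε) := sub_pos.2 (Real.exp_lt_one_iff.2 (by linarith))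
  obtain ⟨c, hc, n₀, hn₀⟩ := exists_le_boxConv (abs_uParam_lt_one y) hδ
    (by linarith [Real.exp_pos (-ε)])
  refine ⟨Real.log c - t - Real.log 2 - logSinhc y, ?_⟩
  filter_upwards [eventually_ge_atTop n₀] with n hn
  have key : Real.exp (Real.log c - t - Real.log 2 - logSinhc y - (n + 1) * ε +
      (n + 1) * (uParam y * y + logSinhc y)) ≤ meanDensity (n + 1) t (uParam y) := by
    refine le_trans ?_ (le_meanDensity_succ ht n _)
    have h := hn₀ n hn
    rw [sub_sub_cancel] at h
    calc _ ≤ Real.exp (Real.log c - t - Real.log 2 + n * (-ε) + n * logSinhc y +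
          y * ((n + 1) * uParam y)) := by
          apply Real.exp_le_exp.2; linarith
      _ = Real.exp (-t) * (1 * ((1 / 2) ^ (n + 1) * (c * (Real.exp (-ε) *
          (2 * Real.exp (logSinhc y))) ^ n * Real.exp (y * ((n + 1) * uParam y))))) := by
          rw [Real.exp_add, Real.exp_add, Real.exp_add, Real.exp_sub, Real.exp_sub,
            Real.exp_log hc, Real.exp_log two_pos, Real.exp_nat_mul, Real.exp_nat_mul, mul_pow,
            mul_pow, one_div_pow, pow_succ, Real.exp_neg t]
          field_simp
      _ ≤ _ := by
          have : (1 : ℝ) ≤ n + 1 := by linarith [n.cast_nonneg (α := ℝ)]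
          gcongr
  have hpos := (Real.exp_pos _).trans_le key
  exact ⟨hpos, (Real.le_log_iff_exp_le hpos).2 key⟩

lemma eventually_meanDensity_pos {t : ℝ} (ht : 0 ≤ t) (y : ℝ) :
    ∀ᶠ N : ℕ in atTop, 0 < meanDensity N t (uParam y) := by
  obtain ⟨_, hK⟩ := exists_le_log_meanDensity_succ ht y one_pos
  have := (tendsto_sub_atTop_nat 1).eventually hK
  filter_upwards [this, eventually_ge_atTop 1] with N hN h1
  rw [Nat.sub_add_cancel h1] at hN
  exact hN.1

lemma tendsto_log_meanDensity_div {t : ℝ} (ht : 0 ≤ t) (y : ℝ) :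
    Tendsto (fun N : ℕ => Real.log (meanDensity N t (uParam y)) / N) atTop
      (𝓝 (uParam y * y + logSinhc y)) := by
  rw [← tendsto_add_atTop_iff_nat 1]
  set I := uParam y * y + logSinhc y with hI
  have hN : Tendsto (fun n : ℕ => (n : ℝ) + 1) atTop atTop :=
    tendsto_atTop_add_const_right _ _ tendsto_natCast_atTop_atTop
  have hlog : Tendsto (fun n : ℕ => Real.log ((n : ℝ) + 1) / ((n : ℝ) + 1)) atTop (𝓝 0) :=
    Real.isLittleO_log_id_atTop.tendsto_div_nhds_zero.comp hN
  have hconst : ∀ K : ℝ, Tendsto (fun n : ℕ => K / ((n : ℝ) + 1)) atTop (𝓝 0) := fun K =>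
    hN.const_div_atTop K
  rw [tendsto_order]
  constructor
  · intro a ha
    obtain ⟨K, hK⟩ := exists_le_log_meanDensity_succ ht y (half_pos (sub_pos.2 ha))
    filter_upwards [hK, (hconst K).eventually (lt_mem_nhds
      (show -((I - a) / 2) < 0 by linarith))] with n hn hn'
    have h0 : (0 : ℝ) < n + 1 := by positivity
    push_cast
    rw [lt_div_iff₀ h0] at hn' ⊢
    linarith [hn.2]
  · intro a ha
    obtain ⟨_, hK⟩ := exists_le_log_meanDensity_succ ht y one_pos
    have h1 := ((hconst (t + |y| - logSinhc y - Real.log 2)).add hlog).add_const I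
    rw [add_zero, zero_add] at h1
    filter_upwards [hK, h1.eventually (gt_mem_nhds ha)] with n hn hn'
    have h0 : (0 : ℝ) < n + 1 := by positivity
    have h2 := log_meanDensity_succ_le ht y n hn.1
    rw [← hI] at h2
    refine lt_of_le_of_lt ?_ hn'
    push_cast
    rw [← add_div, div_add' _ _ _ h0.ne', div_le_div_iff_of_pos_right h0]
    linarith

/-! ### Identification of the leading exponent -/

lemma eventually_ne_zero_of_tendsto_ratio {a : ℕ → ℝ}
    (ha : Tendsto (fun N => a (N + 1) / a N) atTop (𝓝 1)) : ∀ᶠ N in atTop, a N ≠ 0 := by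
  filter_upwards [ha.eventually_ne one_ne_zero] with N hN h0
  exact hN (by rw [h0, div_zero])

/-- The increments of `Real.log (a N)` tend to zero, hence so do their Cesàro means. Signs are
harmless, as `Real.log` depends only on the absolute value. -/
lemma tendsto_log_div_of_tendsto_ratio {a : ℕ → ℝ}
    (ha : Tendsto (fun N => a (N + 1) / a N) atTop (𝓝 1)) :
    Tendsto (fun N : ℕ => Real.log (a N) / N) atTop (𝓝 0) := by
  have h1 : Tendsto (fun N => Real.log (a (N + 1)) - Real.log (a N)) atTop (𝓝 0) := by
    have h := (Real.continuousAt_log one_ne_zero).tendsto.comp ha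
    rw [Real.log_one] at h
    refine h.congr' ?_
    filter_upwards [ha.eventually_ne one_ne_zero] with N hN
    have := div_ne_zero_iff.1 hN
    exact Real.log_div this.1 this.2
  have h2 := h1.cesaro
  have h3 : Tendsto (fun N : ℕ => Real.log (a 0) / N) atTop (𝓝 0) :=
    tendsto_natCast_atTop_atTop.const_div_atTop _
  have h4 := h2.add h3
  rw [add_zero] at h4
  refine h4.congr fun N => ?_
  rw [Finset.sum_range_sub (fun N => Real.log (a N))]
  ring

section

variable {t : ℝ} {A : ℕ → ℝ → ℝ} {f : ℝ → ℝ → EReal}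

lemma HasAsymptoticForm.tendsto_exponent (h : HasAsymptoticForm t A f) (ht : 0 ≤ t) {u : ℝ}
    (hu : u ∈ Icc (-1 : ℝ) 1) : Tendsto (fun N : ℕ => f (t / N) u) atTop (𝓝 (f 0 u)) := by
  refine (h.continuous_zero u hu).tendsto.comp (tendsto_nhdsWithin_iff.2 ⟨?_, ?_⟩)
  · exact tendsto_natCast_atTop_atTop.const_div_atTop t
  · exact Eventually.of_forall fun N => by simp only [mem_Ici]; positivity

lemma tendsto_zero_of_isBigO_one_div {r : ℕ → ℝ} (hr : r =O[atTop] (fun N : ℕ => 1 / (N : ℝ))) :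
    Tendsto r atTop (𝓝 0) :=
  hr.trans_tendsto tendsto_one_div_atTop_nhds_zero_nat

/-- Eventually neither `A N u` nor `1 + r N` vanishes, so the exponential factor must, and `f (t /
N) u = ⊥` passes to the limit. -/
lemma HasAsymptoticForm.eq_bot (h : HasAsymptoticForm t A f) (ht : 0 ≤ t) {u : ℝ}
    (hu : u ∈ Icc (-1 : ℝ) 1) (h0 : ∀ᶠ N : ℕ in atTop, meanDensity N t u = 0) : f 0 u = ⊥ := by
  obtain ⟨r, hr, has⟩ := h.asymptotic u hu
  have hr1 : ∀ᶠ N in atTop, 1 + r N ≠ 0 :=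
    ((tendsto_zero_of_isBigO_one_div hr).const_add 1).eventually_ne (by norm_num)
  have hbot : (fun _ : ℕ => (⊥ : EReal)) =ᶠ[atTop] fun N : ℕ => f (t / N) u := by
    filter_upwards [has, h0, hr1,
      eventually_ne_zero_of_tendsto_ratio (a := fun N => A N u) (h.ratio u hu)]
      with N h1 h2 h3 h4
    rw [h2, eq_comm, mul_eq_zero, mul_eq_zero, or_iff_left h3, or_iff_right h4] at h1
    have hlt := h.lt_top (t / N) (by positivity) u hu
    induction hx : f (t / N) u with
    | bot => rfl
    | top => exact absurd hx hlt.ne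
    | coe x =>
      rw [hx, show ((N : EReal) * (x : EReal)) = ((N * x : ℝ) : EReal) by push_cast; rfl,
        EReal.exp_coe, ENNReal.toReal_ofReal (Real.exp_pos _).le] at h1
      exact absurd h1 (Real.exp_pos _).ne'
  exact tendsto_nhds_unique (h.tendsto_exponent ht hu) (tendsto_const_nhds.congr' hbot)

/-- Positivity of the density excludes `⊥`, so logarithms divided by `N` express `f (t / N) u`
through three sequences with known limits. -/
lemma HasAsymptoticForm.eq_coe (h : HasAsymptoticForm t A f) (ht : 0 ≤ t) (y : ℝ) :
    f 0 (uParam y) = ((uParam y * y + logSinhc y : ℝ) : EReal) := by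
  have hu : uParam y ∈ Icc (-1 : ℝ) 1 := Ioo_subset_Icc_self (uParam_mem y)
  obtain ⟨r, hr, has⟩ := h.asymptotic _ hu
  have hr0 := (tendsto_zero_of_isBigO_one_div hr).const_add 1
  rw [add_zero] at hr0
  have hlogr : Tendsto (fun N : ℕ => Real.log (1 + r N) / N) atTop (𝓝 0) := by
    have h1 := ((Real.continuousAt_log one_ne_zero).tendsto.comp hr0).mul
      tendsto_one_div_atTop_nhds_zero_nat
    rw [mul_zero] at h1
    exact h1.congr fun N => mul_one_div _ _
  have hlim := ((tendsto_log_meanDensity_div ht y).sub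
    (tendsto_log_div_of_tendsto_ratio (a := fun N => A N (uParam y)) (h.ratio _ hu))).sub hlogr
  rw [sub_zero, sub_zero] at hlim
  have hcoe : (fun N : ℕ => ((Real.log (meanDensity N t (uParam y)) / N -
      Real.log (A N (uParam y)) / N - Real.log (1 + r N) / N : ℝ) : EReal)) =ᶠ[atTop]
      fun N : ℕ => f (t / N) (uParam y) := by
    filter_upwards [has, eventually_meanDensity_pos ht y, eventually_gt_atTop 0] with N h1 h2 hN
    have hN' : (0 : ℝ) < N := by exact_mod_cast hN
    have hlt := h.lt_top (t / N) (by positivity) _ hu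
    induction hx : f (t / N) (uParam y) with
    | bot =>
      rw [hx, EReal.mul_bot_of_pos (by exact_mod_cast hN), EReal.exp_bot] at h1
      simp only [ENNReal.toReal_zero, mul_zero, zero_mul] at h1
      exact absurd h1 h2.ne'
    | top => exact absurd hx hlt.ne
    | coe x =>
      rw [hx, show ((N : EReal) * (x : EReal)) = ((N * x : ℝ) : EReal) by push_cast; rfl,
        EReal.exp_coe, ENNReal.toReal_ofReal (Real.exp_pos _).le] at h1
      have hne := h2.ne'
      rw [h1] at hne
      have hne' := mul_ne_zero_iff.1 hne
      rw [h1, Real.log_mul hne'.1 hne'.2, Real.log_mul (left_ne_zero_of_mul hne'.1)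
        (Real.exp_pos _).ne', Real.log_exp, EReal.coe_eq_coe_iff]
      field_simp
      ring
  exact tendsto_nhds_unique (h.tendsto_exponent ht hu)
    (((continuous_coe_real_ereal.tendsto _).comp hlim).congr' hcoe)

/-! ### Limits at the end points and the graph of slab rates -/

lemma tendsto_legendre_bot {F : ℝ → EReal}
    (hF : ∀ y, F (uParam y) = ((uParam y * y + logSinhc y : ℝ) : EReal)) {l : Filter ℝ} {x : ℝ}
    (hx : x = 1 ∨ x = -1) (hl : l ≤ 𝓝 x) (hI : ∀ᶠ u in l, u ∈ Ioo (-1 : ℝ) 1) :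
    Tendsto F l (𝓝 ⊥) := by
  rw [EReal.tendsto_nhds_bot_iff_real]
  intro a
  -- The transform is at most its value for the fixed competitor `-(s * x)`. At `u = x` this is at
  -- most `-log (2 * s) = a - 1`, so by continuity it stays below `a` near `x`.
  set s := Real.exp (1 - a) / 2 with hs
  have hs0 : 0 < s := by positivity
  have hlog : logSinhc (-(s * x)) ≤ s + a - 1 := by
    have h1 : logSinhc (-(s * x)) = logSinhc s := by
      rcases hx with rfl | rfl <;> simp [logSinhc_neg]
    have h2 := logSinhc_le hs0
    rw [show 2 * s = Real.exp (1 - a) by rw [hs]; ring, Real.log_exp] at h2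
    linarith
  have hxx : x * -(s * x) = -s := by rcases hx with rfl | rfl <;> ring
  have hcont : Tendsto (fun u => u * -(s * x)) l (𝓝 (x * -(s * x))) :=
    (tendsto_id.mono_left hl).mul_const _
  filter_upwards [hI, hcont.eventually (gt_mem_nhds (show x * -(s * x) < -s + 1 by linarith))]
    with u hu hlt
  obtain ⟨y, rfl⟩ := exists_uParam_eq hu
  rw [hF, EReal.coe_lt_coe_iff]
  linarith [uParam_mul_add_logSinhc_le y (-(s * x))]

/-- The equivalence contains both existence and uniqueness of the value at each `β`, so `PolyGraph`
is the graph of a function. -/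
lemma polyGraph_iff {F : ℝ → EReal}
    (hF : ∀ y, F (uParam y) = ((uParam y * y + logSinhc y : ℝ) : EReal)) (h1 : F 1 = ⊥)
    (h2 : F (-1) = ⊥) {u : ℝ} (hu : u ∈ Icc (-1 : ℝ) 1) (w : ℝ) :
    PolyGraph ((1 - u) / 2) w ↔ w = (EReal.exp (F u)).toReal := by
  have hexp : ∀ y, (EReal.exp (F (uParam y))).toReal = Real.exp (uParam y * y + logSinhc y) := by
    intro y
    rw [hF, EReal.exp_coe, ENNReal.toReal_ofReal (Real.exp_pos _).le]
  have h0 : (EReal.exp (F 0)).toReal = 1 := by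
    have := hexp 0
    simpa [uParam_zero, logSinhc_zero] using this
  constructor
  · intro h
    generalize hβ : (1 - u) / 2 = β at h
    cases h with
    | zero => rw [show u = 1 by linarith, h1]; simp
    | one => rw [show u = -1 by linarith, h2]; simp
    | half => rw [show u = 0 by linarith, h0]
    | param z hz hz1 =>
      have hy : -Real.log z / 2 ≠ 0 := by
        have := Real.log_ne_zero_of_pos_of_ne_one hz hz1
        simpa using this
      have hz' : Real.exp (-2 * (-Real.log z / 2)) = z := by
        rw [show -2 * (-Real.log z / 2) = Real.log z by ring, Real.exp_log hz]
      have hb := polyBeta_exp hy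
      have hr := polyRate_exp hy
      rw [hz'] at hb hr
      rw [hr, show u = uParam (-Real.log z / 2) by linarith, hexp]
  · rintro rfl
    rcases eq_or_lt_of_le hu.1 with rfl | hl
    · rw [h2]; norm_num; exact PolyGraph.one
    rcases eq_or_lt_of_le hu.2 with rfl | hr
    · rw [h1]; norm_num; exact PolyGraph.zero
    obtain ⟨y, rfl⟩ := exists_uParam_eq ⟨hl, hr⟩
    rcases eq_or_ne y 0 with rfl | hy
    · rw [uParam_zero, h0, sub_zero]; exact PolyGraph.half
    · rw [hexp, ← polyRate_exp hy, ← polyBeta_exp hy]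
      refine PolyGraph.param _ (Real.exp_pos _) fun h => hy ?_
      simpa using (Real.exp_eq_one_iff _).1 h

end

end RelBrownian

theorem theorem3p1 (t : ℝ) (ht : 0 ≤ t) (A : ℕ → ℝ → ℝ) (f : ℝ → ℝ → EReal)
    (h : HasAsymptoticForm t A f) :
    -- the parametrization `u = 1 / y - coth y` of `(-1, 1)`
    (Continuous uParam ∧ StrictAnti uParam ∧ BijOn uParam univ (Ioo (-1) 1) ∧ uParam 0 = 0 ∧
      Tendsto uParam atBot (𝓝 1) ∧ Tendsto uParam atTop (𝓝 (-1))) ∧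
    -- the parametric formula for the leading exponent
    (∀ y : ℝ, f 0 (uParam y) = ((uParam y * y + logSinhc y : ℝ) : EReal)) ∧
    -- the special values, and the limits at the end points
    (f 0 0 = 0 ∧ f 0 1 = ⊥ ∧ f 0 (-1) = ⊥ ∧
      Tendsto (f 0) (𝓝[<] 1) (𝓝 ⊥) ∧ Tendsto (f 0) (𝓝[>] (-1)) (𝓝 ⊥)) ∧
    -- the parameter is the derivative, and the exponent is the singular Clairaut solution
    ((∀ y : ℝ, HasDerivAt (fun u => (f 0 u).toReal) y (uParam y)) ∧
      IsSingularClairautSolution logSinhc (fun u => (f 0 u).toReal) (Ioo (-1) 1) ∧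
      ∀ g : ℝ → ℝ, IsSingularClairautSolution logSinhc g (Ioo (-1) 1) →
        EqOn g (fun u => (f 0 u).toReal) (Ioo (-1) 1)) ∧
    -- agreement with the method of polyhedra, `β = (1 - u) / 2` and `z = exp (-2 y)`
    ((∀ N : ℕ, 1 ≤ N → ∀ u ∈ Icc (-1 : ℝ) 1,
        meanDensity N 0 u = N / 2 * volume.real (cubeSlab N ((1 - u) / 2))) ∧
      (∀ y : ℝ, y ≠ 0 → polyBeta (Real.exp (-2 * y)) = (1 - uParam y) / 2 ∧
        polyRate (Real.exp (-2 * y)) = (EReal.exp (f 0 (uParam y))).toReal) ∧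
      ∀ u ∈ Icc (-1 : ℝ) 1, ∀ w : ℝ,
        PolyGraph ((1 - u) / 2) w ↔ w = (EReal.exp (f 0 u)).toReal) := by
  have hF := h.eq_coe ht
  have hbot : ∀ x : ℝ, x = 1 ∨ x = -1 → f 0 x = ⊥ := fun x hx =>
    h.eq_bot ht (by rcases hx with rfl | rfl <;> norm_num)
      ((eventually_ge_atTop 2).mono fun N hN => meanDensity_endpoint ht hN hx)
  have h1 := hbot 1 (Or.inl rfl)
  have h2 := hbot (-1) (Or.inr rfl)
  have hG : ∀ y, (fun u => (f 0 u).toReal) (uParam y) = uParam y * y + logSinhc y := fun y => by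
    simp only [hF, EReal.toReal_coe]
  have hz := hF 0
  rw [uParam_zero, logSinhc_zero, zero_mul, add_zero, EReal.coe_zero] at hz
  refine ⟨⟨continuous_uParam, strictAnti_uParam, bijOn_uParam, uParam_zero, tendsto_uParam_atBot,
    tendsto_uParam_atTop⟩, hF, ⟨hz, h1, h2, ?_, ?_⟩, ⟨hasDerivAt_of_legendre hG,
    isSingularClairautSolution_legendre hG,
    fun g hg => eqOn_legendre_of_isSingularClairautSolution hG hg⟩,
    fun N hN u _ => meanDensity_zero_eq_cubeSlab N hN u, fun y hy => ⟨polyBeta_exp hy, ?_⟩,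
    fun u hu w => polyGraph_iff hF h1 h2 hu w⟩
  · exact tendsto_legendre_bot hF (Or.inl rfl) nhdsWithin_le_nhds (Ioo_mem_nhdsLT (by norm_num))
  · exact tendsto_legendre_bot hF (Or.inr rfl) nhdsWithin_le_nhds (Ioo_mem_nhdsGT (by norm_num))
  · rw [polyRate_exp hy, hF, EReal.exp_coe, ENNReal.toReal_ofReal (Real.exp_pos _).le]
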